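/- Let $\alpha\ge\beta\ge-\tfrac12$ be real with $\alpha>-\tfrac12$, put $\rho=\alpha+\beta+1$ and $A(x)=(2\sinh x)^{2\alpha+1}(2\cosh x)^{2\beta+1}$ for $x>0$, let $\mu$ be the measure $A(x)\,dx$ on $(0,\infty)$, and let $\Delta u=-u''-\frac{A'}{A}u'$. Let $\mathcal D^\sharp(\mathbb R^+)$ be the space of restrictions to $(0,\infty)$ of smooth, even, compactly supported functions $\mathbb R\to\mathbb C$, and let $\Delta_p$ be the closure in $L^p(\mu)$ of the operator $\Delta$ with domain $\mathcal D^\sharp(\mathbb R^+)$. For $\lambda\in\mathbb C$ let $\varphi_\lambda(x)={}_2F_1\big(\tfrac12(\rho-i\lambda),\tfrac12(\rho+i\lambda);\alpha+1;-\sinh^2x\big)$, $x\in\mathbb R$, be the Jacobi function, where ${}_2F_1$ is the principal branch (equivalently, $\varphi_\lambda$ is the real-analytic function on $\mathbb R$ given by the Gauss series where $\sinh^2x<1$). Let $2<p<\infty$, $S_p=\{\lambda\in\mathbb C:|\operatorname{Im}\lambda|\le|1-\tfrac2p|\rho\}$ and $P_p=\{\lambda^2+\rho^2:\lambda\in S_p^\circ\}$,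 where $S_p^\circ$ is the interior of $S_p$. Then for every $\lambda\in S_p^\circ$, with $z=\lambda^2+\rho^2$, the Jacobi function $\varphi_\lambda$ exists, satisfies $\Delta\varphi_\lambda(x)=z\,\varphi_\lambda(x)$ for all $x>0$, defines a nonzero element of $L^p(\mu)$, belongs to the domain of $\Delta_p$, and satisfies $\Delta_p\varphi_\lambda=z\,\varphi_\lambda$. In particular every $z\in P_p$ has a nonzero eigenfunction in $L^p(\mu)$, and $P_p$ is contained in the point spectrum (set of eigenvalues) of $\Delta_p$. -/

import Mathlib

open MeasureTheory Set
open scoped ENNReal ContDiff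

noncomputable section

namespace JacobiAnalysis

/-- `ρ = α + β + 1`. -/
def rho (α β : ℝ) : ℝ := α + β + 1

/-- The weight `A(x) = (2 sinh x)^(2α+1) (2 cosh x)^(2β+1)`; it is only used for `x > 0`. -/
def weight (α β x : ℝ) : ℝ :=
  (2 * Real.sinh x) ^ (2 * α + 1) * (2 * Real.cosh x) ^ (2 * β + 1)

/-- The measure `μ` with density `A` with respect to Lebesgue measure on `(0, ∞)`, as a measure
on `ℝ` carried by `(0, ∞)`. -/
def mu (α β : ℝ) : Measure ℝ :=
  (volume.restrict (Ioi (0 : ℝ))).withDensity fun x => ENNReal.ofReal (weight α β x)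

/-- The Jacobi operator `Δ u = - u'' - (A' / A) u'`, used at points `x > 0`. -/
def jacobiOp (α β : ℝ) (u : ℝ → ℂ) (x : ℝ) : ℂ :=
  -deriv (deriv u) x - ((deriv (weight α β) x / weight α β x : ℝ) : ℂ) * deriv u x

/-- `φ` is the Jacobi function `φ_lam(x) = ₂F₁((ρ - i lam)/2, (ρ + i lam)/2; α + 1; - sinh² x)`.
Mathlib's `₂F₁` is the sum of the Gauss series, so that this formula is imposed where
`sinh² x < 1`; on the rest of `ℝ`, `φ` is the real-analytic continuation. As `- sinh² x` stays in
`(-∞, 0]`, this is the principal branch of the hypergeometric function on `ℂ ∖ [1, ∞)`. -/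
def IsJacobiFunction (α β : ℝ) (lam : ℂ) (φ : ℝ → ℂ) : Prop :=
  AnalyticOnNhd ℝ φ univ ∧
  ∀ x : ℝ, Real.sinh x ^ 2 < 1 →
    φ x = ordinaryHypergeometric (𝕂 := ℂ)
      ((rho α β - Complex.I * lam) / 2) ((rho α β + Complex.I * lam) / 2) ((α : ℂ) + 1)
      (-((Real.sinh x : ℝ) : ℂ) ^ 2)

/-- There is at most one Jacobi function of given order and parameter. -/
theorem IsJacobiFunction.unique {α β : ℝ} {lam : ℂ} {φ ψ : ℝ → ℂ}
    (hφ : IsJacobiFunction α β lam φ) (hψ : IsJacobiFunction α β lam ψ) : φ = ψ := by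
  refine hφ.1.eq_of_eventuallyEq hψ.1 (z₀ := 0) ?_
  have h : ∀ᶠ x : ℝ in nhds 0, Real.sinh x ^ 2 < 1 := by
    have hc : Continuous fun x : ℝ => Real.sinh x ^ 2 := Real.continuous_sinh.pow 2
    exact hc.continuousAt.eventually_lt continuousAt_const (by simp)
  filter_upwards [h] with x hx
  rw [hφ.2 x hx, hψ.2 x hx]

/-- `D♯(ℝ)`: the smooth, even, compactly supported functions on `ℝ`. -/
def evenTest : Submodule ℂ (ℝ → ℂ) where
  carrier := {f | ContDiff ℝ ∞ f ∧ (∀ x, f (-x) = f x) ∧ HasCompactSupport f}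
  add_mem' := by
    rintro f g ⟨hf, hf', hf''⟩ ⟨hg, hg', hg''⟩
    exact ⟨hf.add hg, fun x => by simp [hf' x, hg' x], hf''.add hg''⟩
  zero_mem' := ⟨contDiff_const, fun _ => rfl, HasCompactSupport.zero⟩
  smul_mem' := by
    rintro c f ⟨hf, hf', hf''⟩
    refine ⟨contDiff_const.smul hf, fun x => by simp [hf' x], ?_⟩
    exact hf''.smul_left (f := fun _ => c)

theorem evenTest_differentiable {f : ℝ → ℂ} (hf : f ∈ evenTest) : Differentiable ℝ f :=
  hf.1.differentiable (by simp)

theorem evenTest_contDiff_deriv {f : ℝ → ℂ} (hf : f ∈ evenTest) : ContDiff ℝ 1 (deriv f) :=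
  (contDiff_succ_iff_deriv.1 (hf.1.of_le (by norm_num; exact WithTop.coe_le_coe.2 le_top) :
    ContDiff ℝ (1 + 1) f)).2.2

theorem jacobiOp_add (α β : ℝ) {f g : ℝ → ℂ} (hf : f ∈ evenTest) (hg : g ∈ evenTest) :
    jacobiOp α β (f + g) = jacobiOp α β f + jacobiOp α β g := by
  have h1 : deriv (f + g) = deriv f + deriv g := by
    ext x
    exact deriv_add (evenTest_differentiable hf x) (evenTest_differentiable hg x)
  have h2 : deriv (deriv f + deriv g) = deriv (deriv f) + deriv (deriv g) := by
    ext x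
    exact deriv_add ((evenTest_contDiff_deriv hf).differentiable one_ne_zero x)
      ((evenTest_contDiff_deriv hg).differentiable one_ne_zero x)
  ext x
  simp only [jacobiOp, h1, h2, Pi.add_apply]
  ring

theorem jacobiOp_smul (α β : ℝ) (c : ℂ) {f : ℝ → ℂ} (hf : f ∈ evenTest) :
    jacobiOp α β (c • f) = c • jacobiOp α β f := by
  have h1 : deriv (c • f) = c • deriv f := by
    ext x
    exact deriv_const_smul c (evenTest_differentiable hf x)
  have h2 : deriv (c • deriv f) = c • deriv (deriv f) := by
    ext x
    exact deriv_const_smul c ((evenTest_contDiff_deriv hf).differentiable one_ne_zero x)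
  ext x
  simp only [jacobiOp, h1, h2, Pi.smul_apply, smul_eq_mul]
  ring

/-- The graph `{(f, Δ f) : f ∈ D♯(ℝ⁺)}` of `Δ` in `L^p(μ) × L^p(μ)`. -/
def testGraph (α β : ℝ) (p : ℝ≥0∞) : Submodule ℂ (Lp ℂ p (mu α β) × Lp ℂ p (mu α β)) where
  carrier := {q | ∃ f ∈ evenTest, q.1 =ᵐ[mu α β] f ∧ q.2 =ᵐ[mu α β] jacobiOp α β f}
  add_mem' := by
    rintro q r ⟨f, hf, hf1, hf2⟩ ⟨g, hg, hg1, hg2⟩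
    refine ⟨f + g, evenTest.add_mem hf hg, ?_, ?_⟩
    · exact (Lp.coeFn_add _ _).trans (hf1.add hg1)
    · rw [jacobiOp_add α β hf hg]
      exact (Lp.coeFn_add _ _).trans (hf2.add hg2)
  zero_mem' := by
    refine ⟨0, evenTest.zero_mem, Lp.coeFn_zero _ _ _, ?_⟩
    have h : jacobiOp α β 0 = 0 := by
      have := jacobiOp_smul α β 0 evenTest.zero_mem
      simpa using this
    rw [h]
    exact Lp.coeFn_zero _ _ _
  smul_mem' := by
    rintro c q ⟨f, hf, hf1, hf2⟩
    refine ⟨c • f, evenTest.smul_mem c hf, ?_, ?_⟩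
    · exact (Lp.coeFn_smul _ _).trans (hf1.const_smul c)
    · rw [jacobiOp_smul α β c hf]
      exact (Lp.coeFn_smul _ _).trans (hf2.const_smul c)

/-- `Δ` as an unbounded operator in `L^p(μ)` with domain `D♯(ℝ⁺)`. -/
def jacobiTest (α β : ℝ) (p : ℝ≥0∞) : Lp ℂ p (mu α β) →ₗ.[ℂ] Lp ℂ p (mu α β) :=
  (testGraph α β p).toLinearPMap

/-- `Δ_p`: the closure in `L^p(μ)` of `Δ` with domain `D♯(ℝ⁺)`. -/
def jacobiLp (α β : ℝ) (p : ℝ≥0∞) [Fact (1 ≤ p)] :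
    Lp ℂ p (mu α β) →ₗ.[ℂ] Lp ℂ p (mu α β) :=
  (jacobiTest α β p).closure

/-- The set of eigenvalues of an unbounded operator. -/
def pointSpectrum {E : Type*} [AddCommGroup E] [Module ℂ E] (T : E →ₗ.[ℂ] E) : Set ℂ :=
  {z | ∃ u : T.domain, (u : E) ≠ 0 ∧ T u = z • (u : E)}

/-- The closed strip `S_p = {lam : |Im lam| ≤ |1 - 2/p| ρ}`. -/
def strip (α β : ℝ) (p : ℝ≥0∞) : Set ℂ :=
  {lam | |lam.im| ≤ |1 - 2 / p.toReal| * rho α β}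

/-- The parabolic region `P_p = {lam² + ρ² : lam ∈ S_p°}`. -/
def parabolicRegion (α β : ℝ) (p : ℝ≥0∞) : Set ℂ :=
  (fun lam : ℂ => lam ^ 2 + (rho α β : ℂ) ^ 2) '' interior (strip α β p)

/-! The following facts show that `jacobiTest` is the intended operator: a test function and its
image under `Δ` lie in `L^p(μ)`, and the class of the function determines the class of the
image. -/

theorem weight_pos (α β : ℝ) {x : ℝ} (hx : 0 < x) : 0 < weight α β x := by
  have h1 : 0 < Real.sinh x := Real.sinh_pos_iff.2 hx
  have h2 : 0 < Real.cosh x := Real.cosh_pos x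
  unfold weight
  positivity

theorem measurable_weight (α β : ℝ) : Measurable (weight α β) := by
  unfold weight
  have h1 : Measurable fun x : ℝ => 2 * Real.sinh x :=
    (Real.continuous_sinh.measurable).const_mul 2
  have h2 : Measurable fun x : ℝ => 2 * Real.cosh x :=
    (Real.continuous_cosh.measurable).const_mul 2
  exact (h1.pow_const _).mul (h2.pow_const _)

theorem hasDerivAt_weight (α β : ℝ) {x : ℝ} (hx : 0 < x) :
    HasDerivAt (weight α β) (weight α β x *
      ((2 * α + 1) * (Real.cosh x / Real.sinh x) +
        (2 * β + 1) * (Real.sinh x / Real.cosh x))) x := by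
  have h1 : 0 < Real.sinh x := Real.sinh_pos_iff.2 hx
  have h2 : 0 < Real.cosh x := Real.cosh_pos x
  have hs := ((Real.hasDerivAt_sinh x).const_mul 2).rpow_const (p := 2 * α + 1)
    (Or.inl (by positivity))
  have hc := ((Real.hasDerivAt_cosh x).const_mul 2).rpow_const (p := 2 * β + 1)
    (Or.inl (by positivity))
  have h := hs.mul hc
  refine h.congr_deriv ?_
  rw [Real.rpow_sub_one (by positivity), Real.rpow_sub_one (by positivity)]
  unfold weight
  field_simp

theorem ae_mu_iff (α β : ℝ) {P : ℝ → Prop} :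
    (∀ᵐ x ∂(mu α β), P x) ↔ ∀ᵐ x ∂(volume.restrict (Ioi (0 : ℝ))), P x := by
  unfold mu
  rw [ae_withDensity_iff (measurable_weight α β).ennreal_ofReal]
  constructor
  · intro h
    filter_upwards [h, ae_restrict_mem measurableSet_Ioi] with x hx hx0
    exact hx (by simpa using weight_pos α β hx0)
  · intro h
    filter_upwards [h] with x hx _ using hx

theorem testGraph_functional (α β : ℝ) (p : ℝ≥0∞)
    (q : Lp ℂ p (mu α β) × Lp ℂ p (mu α β)) (hq : q ∈ testGraph α β p) (h0 : q.1 = 0) :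
    q.2 = 0 := by
  obtain ⟨f, hf, hf1, hf2⟩ := hq
  rw [h0] at hf1
  have hae : f =ᵐ[mu α β] 0 := hf1.symm.trans (Lp.coeFn_zero _ _ _)
  have hE : EqOn f (fun _ => 0) (Ioi 0) :=
    Measure.eqOn_open_of_ae_eq ((ae_mu_iff α β).1 hae) isOpen_Ioi
      (evenTest_differentiable hf).continuous.continuousOn continuousOn_const
  have hd : EqOn (deriv f) (fun _ => 0) (Ioi 0) := by
    simpa using hE.deriv isOpen_Ioi
  have hdd : EqOn (deriv (deriv f)) (fun _ => 0) (Ioi 0) := by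
    simpa using hd.deriv isOpen_Ioi
  have hz : jacobiOp α β f =ᵐ[mu α β] 0 := by
    refine (ae_mu_iff α β).2 ?_
    filter_upwards [ae_restrict_mem measurableSet_Ioi] with x hx
    simp [jacobiOp, hd hx, hdd hx]
  rw [Lp.eq_zero_iff_ae_eq_zero]
  exact hf2.trans hz

theorem memLp_of_bound (α β : ℝ) (hα : -1 / 2 ≤ α) (p : ℝ≥0∞) {g : ℝ → ℂ} (hg : Measurable g)
    {R C : ℝ} (hb : ∀ x, 0 < x → ‖g x‖ ≤ C) (hs : ∀ x, R < x → g x = 0) :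
    MemLp g p (mu α β) := by
  have hfin : mu α β (Iic R) ≠ ⊤ := by
    have hR : mu α β (Iic R) = ∫⁻ x in Ioc 0 R, ENNReal.ofReal (weight α β x) := by
      unfold mu
      rw [withDensity_apply _ measurableSet_Iic, Measure.restrict_restrict measurableSet_Iic,
        inter_comm, Ioi_inter_Iic]
    rw [hR]
    have hcont : Continuous (weight α β) := by
      unfold weight
      refine Continuous.mul ?_ ?_
      · exact (Real.continuous_sinh.const_mul 2).rpow_const fun x => Or.inr (by linarith)
      · refine (Real.continuous_cosh.const_mul 2).rpow_const fun x => Or.inl ?_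
        have := Real.cosh_pos x
        positivity
    have hint : IntegrableOn (weight α β) (Ioc 0 R) :=
      (hcont.integrableOn_Icc (a := 0) (b := R)).mono_set Ioc_subset_Icc_self
    exact ((lintegral_ofReal_le_lintegral_enorm _).trans_lt hint.2).ne
  have hC : MemLp ((Iic R).indicator fun _ : ℝ => C) p (mu α β) :=
    memLp_indicator_const p measurableSet_Iic C (Or.inr hfin)
  refine hC.mono' hg.aestronglyMeasurable ?_
  refine (ae_mu_iff α β).2 ?_
  filter_upwards [ae_restrict_mem measurableSet_Ioi] with x hx
  by_cases hxR : x ≤ R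
  · simpa [indicator, hxR] using hb x hx
  · simp [indicator, hxR, hs x (not_le.1 hxR)]

theorem evenTest_support {f : ℝ → ℂ} (hf : f ∈ evenTest) :
    ∃ R : ℝ, 0 < R ∧ ∀ x, R < x → f x = 0 ∧ deriv f x = 0 ∧ deriv (deriv f) x = 0 := by
  obtain ⟨R, hR0, hR⟩ := hf.2.2.isBounded.exists_pos_norm_le
  have hE : EqOn f (fun _ => 0) (Ioi R) := by
    intro x hx
    by_contra h
    have := hR x (subset_tsupport f h)
    rw [Real.norm_eq_abs] at this
    exact absurd ((le_abs_self x).trans this) (not_le.2 hx)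
  have hd : EqOn (deriv f) (fun _ => 0) (Ioi R) := by
    simpa using hE.deriv isOpen_Ioi
  have hdd : EqOn (deriv (deriv f)) (fun _ => 0) (Ioi R) := by
    simpa using hd.deriv isOpen_Ioi
  exact ⟨R, hR0, fun x hx => ⟨hE hx, hd hx, hdd hx⟩⟩

theorem evenTest_memLp {α β : ℝ} (hα : -1 / 2 ≤ α) (p : ℝ≥0∞) {f : ℝ → ℂ}
    (hf : f ∈ evenTest) : MemLp f p (mu α β) := by
  obtain ⟨R, -, hR⟩ := evenTest_support hf
  have hc := (evenTest_differentiable hf).continuous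
  obtain ⟨C, hC⟩ := hf.2.2.exists_bound_of_continuous hc
  exact memLp_of_bound α β hα p hc.measurable (fun x _ => hC x) fun x hx => (hR x hx).1

theorem jacobiOp_memLp {α β : ℝ} (hα : -1 / 2 ≤ α) (p : ℝ≥0∞) {f : ℝ → ℂ}
    (hf : f ∈ evenTest) : MemLp (jacobiOp α β f) p (mu α β) := by
  obtain ⟨R, hR0, hR⟩ := evenTest_support hf
  have hf1 := evenTest_contDiff_deriv hf
  have hc2 : Continuous (deriv (deriv f)) := hf1.continuous_deriv le_rfl
  have hs2 : HasCompactSupport (deriv (deriv f)) := hf.2.2.deriv.deriv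
  obtain ⟨C, hC⟩ := hs2.exists_bound_of_continuous hc2
  have hC0 : 0 ≤ C := (norm_nonneg _).trans (hC 0)
  have hd0 : deriv f 0 = 0 := by
    have h : deriv (fun x => f (-x)) 0 = -deriv f (-0) := deriv_comp_neg f 0
    have he : (fun x => f (-x)) = f := funext hf.2.1
    rw [he, neg_zero] at h
    exact self_eq_neg.1 h
  have hlip : ∀ x, 0 < x → ‖deriv f x‖ ≤ C * x := by
    intro x hx
    have := convex_univ.norm_image_sub_le_of_norm_deriv_le (f := deriv f) (C := C)
      (x := 0) (y := x) (fun y _ => hf1.differentiable one_ne_zero y) (fun y _ => hC y)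
      (mem_univ _) (mem_univ _)
    simpa [hd0, abs_of_pos hx] using this
  have hm : Measurable (jacobiOp α β f) := by
    unfold jacobiOp
    refine hc2.measurable.neg.sub (Measurable.mul ?_ hf1.continuous.measurable)
    exact Complex.measurable_ofReal.comp ((measurable_deriv _).div (measurable_weight α β))
  refine memLp_of_bound α β hα p hm (R := R)
    (C := C + (|2 * α + 1| * Real.cosh R + |2 * β + 1| * R) * C) (fun x hx => ?_)
    (fun x hx => ?_)
  · by_cases hxR : x ≤ R
    · have h1 : 0 < Real.sinh x := Real.sinh_pos_iff.2 hx
      have h2 : 0 < Real.cosh x := Real.cosh_pos x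
      have hq : deriv (weight α β) x / weight α β x =
          (2 * α + 1) * (Real.cosh x / Real.sinh x) +
            (2 * β + 1) * (Real.sinh x / Real.cosh x) := by
        rw [(hasDerivAt_weight α β hx).deriv, mul_div_cancel_left₀ _ (weight_pos α β hx).ne']
      have hsx : x ≤ Real.sinh x := Real.self_le_sinh_iff.2 hx.le
      have hcR : Real.cosh x ≤ Real.cosh R := by
        rw [Real.cosh_le_cosh, abs_of_pos hx, abs_of_pos hR0]
        exact hxR
      have hcoth : Real.cosh x / Real.sinh x * x ≤ Real.cosh R := by
        rw [div_mul_eq_mul_div, div_le_iff₀ h1]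
        exact mul_le_mul hcR hsx hx.le (h2.le.trans hcR)
      have htanh : Real.sinh x / Real.cosh x * x ≤ R := by
        have : Real.sinh x / Real.cosh x ≤ 1 := (div_le_one h2).2 (Real.sinh_lt_cosh x).le
        calc Real.sinh x / Real.cosh x * x ≤ 1 * x := by gcongr
          _ ≤ R := by linarith
      have hqx : |deriv (weight α β) x / weight α β x| * x ≤
          |2 * α + 1| * Real.cosh R + |2 * β + 1| * R := by
        rw [hq]
        calc _ ≤ (|2 * α + 1| * (Real.cosh x / Real.sinh x) +
              |2 * β + 1| * (Real.sinh x / Real.cosh x)) * x := by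
              gcongr
              refine (abs_add_le _ _).trans ?_
              rw [abs_mul, abs_mul, abs_of_pos (div_pos h2 h1), abs_of_pos (div_pos h1 h2)]
          _ = |2 * α + 1| * (Real.cosh x / Real.sinh x * x) +
              |2 * β + 1| * (Real.sinh x / Real.cosh x * x) := by ring
          _ ≤ _ := by gcongr
      unfold jacobiOp
      calc _ ≤ ‖-deriv (deriv f) x‖ +
            ‖((deriv (weight α β) x / weight α β x : ℝ) : ℂ) * deriv f x‖ := norm_sub_le _ _
        _ ≤ C + |deriv (weight α β) x / weight α β x| * (C * x) := by
            rw [norm_neg, norm_mul, Complex.norm_real, Real.norm_eq_abs]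
            gcongr
            · exact hC x
            · exact hlip x hx
        _ = C + (|deriv (weight α β) x / weight α β x| * x) * C := by ring
        _ ≤ _ := by gcongr
    · have h := hR x (not_le.1 hxR)
      have : jacobiOp α β f x = 0 := by simp [jacobiOp, h.2.1, h.2.2]
      rw [this, norm_zero]
      have := Real.cosh_pos R
      positivity
  · have h := hR x hx
    simp [jacobiOp, h.2.1, h.2.2]

theorem jacobiTest_graph (α β : ℝ) (p : ℝ≥0∞) :
    (jacobiTest α β p).graph = testGraph α β p :=
  Submodule.toLinearPMap_graph_eq _ (testGraph_functional α β p)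

end JacobiAnalysis

end

open JacobiAnalysis

/-!
The eigenfunction is written down by Euler's formula
`B(b, d) ₂F₁(a, b; b + d; z) = ∫₀¹ t^(b-1) (1-t)^(d-1) (1 - z t)^(-a) dt`
with `a`, `b` the numbers `(ρ ± i lam) / 2`, `b` the one with the smaller real part, and
`b + d = α + 1`. Then `0 < re b ≤ ρ / 2 < α + 1`, because `β ≤ α`, so that the integral converges
for every `lam` in the interior of the strip. It is holomorphic for `re z < 1`
(`hasDerivAt_eulerIntegral`), hence real-analytic in `x` at `z = -sinh² x`, and its Taylor
coefficients at `0` are Beta integrals, which identifies it with the Gauss series in the unit disc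
(`eulerIntegral_eq_ordinaryHypergeometric`). Its derivative is an Euler integral with shifted
parameters, and the hypergeometric equation becomes the integral of a total derivative
(`eulerIntegral_contiguous`); the substitution `z = -sinh² x` turns it into
`Δ φ = 4 a b φ = (lam² + ρ²) φ` (`jacobiOp_eulerSinh`).

From `(1 + s t)^(-re a) ≤ (s t)^(-κ)` the function `φ` and its derivative are `O(exp (-2 κ x))` for
each `κ` with `0 ≤ κ < re b = (ρ - |im lam|) / 2` (`exists_bound_eulerSinh`). The density `A` is
`O(exp (2 ρ x))`, and `ρ / p < re b` says exactly that `lam` is in the interior of the strip, so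
`κ` can be chosen with `2 κ p > 2 ρ`; this puts `φ` and its derivative in `L^p(μ)`. Cutting `φ` off
at distance `n` gives even test functions whose images under `Δ` converge as well, so that
`(φ, (lam² + ρ²) φ)` lies in the closure of the graph of `Δ` (`mem_closure_testGraph_of_decay`).

The closure of the graph of `Δ` is the graph of `Δ_p` only because `Δ` is closable. That follows from
the symmetry of `Δ` on even test functions (`integral_jacobiOp_mul`), which passes to the closure of
the graph, since test functions separate the points of `L^p(μ)` (`jacobiTest_isClosable`).
-/

namespace JacobiAnalysis

/-! ### Euler integrals and the Gauss series -/


/-- The Euler integral `∫₀¹ t^(b-1) (1-t)^(d-1) (1 - z t)^(-a) dt`. For positive real parts of `b`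
and `d` it converges and is holomorphic on `{z | re z < 1}`, where it equals
`B(b, d) · ₂F₁(a, b; b + d; z)`. -/
noncomputable def eulerIntegral (a b d z : ℂ) : ℂ :=
  ∫ t : ℝ in (0 : ℝ)..1, (t : ℂ) ^ (b - 1) * (1 - (t : ℂ)) ^ (d - 1) * (1 - z * t) ^ (-a)

theorem one_sub_mul_mem_slitPlane {z : ℂ} (hz : z.re < 1) {t : ℝ} (ht : t ∈ Icc (0 : ℝ) 1) :
    1 - z * t ∈ Complex.slitPlane := by
  refine Or.inl ?_
  have h : (1 - z * t).re = 1 - z.re * t := by simp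
  rw [h]
  rcases le_total z.re 0 with h0 | h0 <;> nlinarith [ht.1, ht.2]

theorem continuousOn_eulerKernel (a : ℂ) {z : ℂ} (hz : z.re < 1) :
    ContinuousOn (fun t : ℝ => (1 - z * (t : ℂ)) ^ (-a)) (uIcc 0 1) := by
  rw [uIcc_of_le zero_le_one]
  refine ContinuousOn.cpow_const (by fun_prop) fun t ht => one_sub_mul_mem_slitPlane hz ht

theorem intervalIntegrable_eulerIntegral (a : ℂ) {b d z : ℂ} (hb : 0 < b.re) (hd : 0 < d.re)
    (hz : z.re < 1) : IntervalIntegrable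
      (fun t : ℝ => (t : ℂ) ^ (b - 1) * (1 - (t : ℂ)) ^ (d - 1) * (1 - z * t) ^ (-a))
      volume 0 1 :=
  (Complex.betaIntegral_convergent hb hd).mul_continuousOn (continuousOn_eulerKernel a hz)

theorem hasDerivAt_eulerIntegral (a : ℂ) {b d z : ℂ} (hb : 0 < b.re) (hd : 0 < d.re)
    (hz : z.re < 1) :
    HasDerivAt (eulerIntegral a b d) (a * eulerIntegral (a + 1) (b + 1) d z) z := by
  obtain ⟨ε, hε, hball⟩ := Metric.nhds_basis_closedBall.mem_iff.1
    ((isOpen_lt Complex.continuous_re continuous_const).mem_nhds hz)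
  -- On the compact set `closedBall z ε ×ˢ [0, 1]` the derivative of the kernel is bounded.
  obtain ⟨C, hC⟩ := ((isCompact_closedBall z ε).prod
    (isCompact_Icc (a := (0 : ℝ)) (b := 1))).exists_bound_of_continuousOn
    (f := fun q : ℂ × ℝ => a * (q.2 : ℂ) * (1 - q.1 * q.2) ^ (-(a + 1))) (by
      refine ContinuousOn.mul (by fun_prop) (ContinuousOn.cpow_const (by fun_prop) ?_)
      exact fun q hq => one_sub_mul_mem_slitPlane (hball hq.1) hq.2)
  have key := (intervalIntegral.hasDerivAt_integral_of_dominated_loc_of_deriv_le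
    (μ := volume) (a := 0) (b := 1)
    (F := fun (x : ℂ) (t : ℝ) =>
      (t : ℂ) ^ (b - 1) * (1 - (t : ℂ)) ^ (d - 1) * (1 - x * t) ^ (-a))
    (F' := fun (x : ℂ) (t : ℝ) => (t : ℂ) ^ (b - 1) * (1 - (t : ℂ)) ^ (d - 1) *
      (a * t * (1 - x * t) ^ (-(a + 1))))
    (bound := fun t : ℝ => ‖(t : ℂ) ^ (b - 1) * (1 - (t : ℂ)) ^ (d - 1)‖ * C)
    (Metric.closedBall_mem_nhds z hε) ?_ (intervalIntegrable_eulerIntegral a hb hd hz) ?_ ?_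
    ((Complex.betaIntegral_convergent hb hd).norm.mul_const C) ?_).2
  · refine key.congr_deriv ?_
    rw [eulerIntegral, ← intervalIntegral.integral_const_mul]
    refine intervalIntegral.integral_congr_ae (ae_of_all _ fun t ht => ?_)
    have ht0 : (t : ℂ) ≠ 0 := by
      rw [uIoc_of_le zero_le_one] at ht
      exact_mod_cast ht.1.ne'
    have : (t : ℂ) ^ (b + 1 - 1) = (t : ℂ) ^ (b - 1) * t := by
      rw [show b + 1 - 1 = (b - 1) + 1 by ring, Complex.cpow_add _ _ ht0, Complex.cpow_one]
    simp only [this]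
    ring
  · filter_upwards [Metric.closedBall_mem_nhds z hε] with x hx
    have := intervalIntegrable_eulerIntegral a hb hd (hball hx)
    rw [intervalIntegrable_iff] at this
    exact this.aestronglyMeasurable
  · have h1 := (Complex.betaIntegral_convergent hb hd).mul_continuousOn
      (g := fun t : ℝ => a * t * (1 - z * (t : ℂ)) ^ (-(a + 1)))
      (ContinuousOn.mul (by fun_prop) (continuousOn_eulerKernel (a + 1) hz))
    rw [intervalIntegrable_iff] at h1
    exact h1.aestronglyMeasurable
  · refine ae_of_all _ fun t ht x hx => ?_
    rw [uIoc_of_le zero_le_one] at ht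
    rw [norm_mul]
    gcongr
    exact hC (x, t) ⟨hx, Ioc_subset_Icc_self ht⟩
  · refine ae_of_all _ fun t ht x hx => ?_
    rw [uIoc_of_le zero_le_one] at ht
    have h1 : HasDerivAt (fun x : ℂ => 1 - x * t) (-(t : ℂ)) x := by
      simpa using ((hasDerivAt_id x).mul_const (t : ℂ)).const_sub 1
    have h2 := h1.cpow_const (c := -a)
      (one_sub_mul_mem_slitPlane (hball hx) (Ioc_subset_Icc_self ht))
    refine (h2.const_mul _).congr_deriv ?_
    rw [show -a - 1 = -(a + 1) by ring]
    ring

theorem iteratedDeriv_eulerIntegral {d : ℂ} (hd : 0 < d.re) (n : ℕ) (a b z : ℂ)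
    (hb : 0 < b.re) (hz : z.re < 1) :
    iteratedDeriv n (eulerIntegral a b d) z =
      (ascPochhammer ℂ n).eval a * eulerIntegral (a + n) (b + n) d z := by
  induction n generalizing z with
  | zero => simp
  | succ n ih =>
    have he : iteratedDeriv n (eulerIntegral a b d) =ᶠ[nhds z]
        fun z => (ascPochhammer ℂ n).eval a * eulerIntegral (a + n) (b + n) d z := by
      filter_upwards [(isOpen_lt Complex.continuous_re continuous_const).mem_nhds hz] with y hy
      exact ih y hy
    have hbn : 0 < (b + n).re := by
      rw [Complex.add_re, Complex.natCast_re]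
      positivity
    rw [iteratedDeriv_succ, he.deriv_eq,
      ((hasDerivAt_eulerIntegral (a + n) hbn hd hz).const_mul _).deriv, ascPochhammer_succ_eval]
    push_cast
    ring_nf

theorem eulerIntegral_zero (a b d : ℂ) : eulerIntegral a b d 0 = Complex.betaIntegral b d := by
  simp [eulerIntegral, Complex.betaIntegral]

theorem ascPochhammer_eval_ne_zero {c : ℂ} (hc : 0 < c.re) (n : ℕ) :
    (ascPochhammer ℂ n).eval c ≠ 0 := by
  induction n with
  | zero => simp
  | succ n ih =>
    rw [ascPochhammer_succ_eval]
    refine mul_ne_zero ih fun h => ?_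
    have := congrArg Complex.re h
    simp only [Complex.add_re, Complex.natCast_re, Complex.zero_re] at this
    have hn : (0 : ℝ) ≤ n := n.cast_nonneg
    linarith

theorem betaIntegral_add_natCast {b d : ℂ} (hb : 0 < b.re) (hd : 0 < d.re) (n : ℕ) :
    Complex.betaIntegral (b + n) d = (ascPochhammer ℂ n).eval b *
      ((ascPochhammer ℂ n).eval (b + d))⁻¹ * Complex.betaIntegral b d := by
  induction n with
  | zero => simp
  | succ n ih =>
    have hbn : 0 < (b + n).re := by
      rw [Complex.add_re, Complex.natCast_re]
      positivity
    have hbd : 0 < (b + n + d).re := by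
      rw [Complex.add_re]
      positivity
    have hne {w : ℂ} (hw : 0 < w.re) : w ≠ 0 := fun h => by simp [h] at hw
    have h1 : Complex.betaIntegral (b + n + 1) d =
        (b + n) / (b + n + d) * Complex.betaIntegral (b + n) d := by
      have hG := Complex.Gamma_ne_zero_of_re_pos hbd
      have hn1 : 0 < (b + n + 1).re := by
        rw [Complex.add_re, Complex.one_re]
        positivity
      rw [Complex.betaIntegral_eq_Gamma_mul_div _ _ hn1 hd,
        Complex.betaIntegral_eq_Gamma_mul_div _ _ hbn hd, Complex.Gamma_add_one _ (hne hbn),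
        show b + n + 1 + d = b + n + d + 1 by ring, Complex.Gamma_add_one _ (hne hbd)]
      have := hne hbd
      field_simp
    have h2 : b + d + n ≠ 0 := by
      rw [show b + d + n = b + n + d by ring]
      exact hne hbd
    have h3 := ascPochhammer_eval_ne_zero (c := b + d) (by rw [Complex.add_re]; positivity) n
    rw [Nat.cast_succ, ← add_assoc, h1, ih, ascPochhammer_succ_eval, ascPochhammer_succ_eval,
      show b + n + d = b + d + n by ring]
    field_simp

theorem differentiableOn_eulerIntegral (a : ℂ) {b d : ℂ} (hb : 0 < b.re) (hd : 0 < d.re) :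
    DifferentiableOn ℂ (eulerIntegral a b d) {z | z.re < 1} := fun _ hz =>
  (hasDerivAt_eulerIntegral a hb hd hz).differentiableAt.differentiableWithinAt

/-- Euler's formula: the Taylor coefficients of the Euler integral at `0` are Beta integrals. -/
theorem eulerIntegral_eq_ordinaryHypergeometric (a : ℂ) {b d z : ℂ} (hb : 0 < b.re)
    (hd : 0 < d.re) (hz : ‖z‖ < 1) :
    eulerIntegral a b d z =
      Complex.betaIntegral b d * ordinaryHypergeometric (𝕂 := ℂ) a b (b + d) z := by
  have hsub : Metric.ball (0 : ℂ) 1 ⊆ {z | z.re < 1} := fun w hw =>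
    (Complex.re_le_norm w).trans_lt (by simpa using hw)
  have hT := Complex.taylorSeries_eq_on_ball ((differentiableOn_eulerIntegral a hb hd).mono hsub)
    (z := z) (by simpa using hz)
  rw [← hT, ordinaryHypergeometric_eq_tsum, ← tsum_mul_left]
  refine tsum_congr fun n => ?_
  rw [iteratedDeriv_eulerIntegral hd n a b 0 hb (by simp), eulerIntegral_zero,
    betaIntegral_add_natCast hb hd]
  simp only [smul_eq_mul, sub_zero]
  ring

/-- The contiguity relation that amounts to the hypergeometric equation. The combination of the
three integrands is the `t`-derivative of `-t^b (1-t)^d (1 - z t)^(-a-1)`, which vanishes at both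
ends of `[0, 1]`. -/
theorem eulerIntegral_contiguous (a : ℂ) {b d z : ℂ} (hb : 0 < b.re) (hd : 0 < d.re)
    (hz : z.re < 1) :
    z * (1 - z) * (a + 1) * eulerIntegral (a + 1 + 1) (b + 1 + 1) d z +
      (b + d - (a + b + 1) * z) * eulerIntegral (a + 1) (b + 1) d z -
        b * eulerIntegral a b d z = 0 := by
  have hb1 : 0 < (b + 1).re := by
    rw [Complex.add_re, Complex.one_re]
    positivity
  have hb2 : 0 < (b + 1 + 1).re := by
    rw [Complex.add_re, Complex.one_re]
    positivity
  have i0 := intervalIntegrable_eulerIntegral a hb hd hz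
  have i1 := intervalIntegrable_eulerIntegral (a + 1) hb1 hd hz
  have i2 := intervalIntegrable_eulerIntegral (a + 1 + 1) hb2 hd hz
  have hint := (((i2.const_mul (z * (1 - z) * (a + 1))).add
    (i1.const_mul (b + d - (a + b + 1) * z))).sub (i0.const_mul b))
  have hcont : ContinuousOn (fun t : ℝ =>
      -((t : ℂ) ^ b * (1 - (t : ℂ)) ^ d * (1 - z * t) ^ (-(a + 1)))) (Icc 0 1) := by
    refine (ContinuousOn.mul (ContinuousOn.mul ?_ ?_) ?_).neg
    · refine continuousOn_of_forall_continuousAt fun x hx => ?_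
      refine (Complex.continuousAt_cpow_const_of_re_pos (Or.inl ?_) hb).comp
        Complex.continuous_ofReal.continuousAt
      simpa using hx.1
    · refine continuousOn_of_forall_continuousAt fun x hx => ?_
      refine (Complex.continuousAt_cpow_const_of_re_pos (Or.inl ?_) hd).comp
        (f := fun x : ℝ => 1 - (x : ℂ)) (by fun_prop)
      simpa using hx.2
    · simpa [uIcc_of_le (zero_le_one' ℝ)] using continuousOn_eulerKernel (a + 1) hz
  have hder : ∀ t ∈ Ioo (0 : ℝ) 1, HasDerivAt (fun t : ℝ =>
      -((t : ℂ) ^ b * (1 - (t : ℂ)) ^ d * (1 - z * t) ^ (-(a + 1)))) _ t := fun t ht => by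
    have hs := one_sub_mul_mem_slitPlane hz (Ioo_subset_Icc_self ht)
    have d1 := ((hasDerivAt_id (t : ℂ)).cpow_const (c := b) (Or.inl (by simpa using ht.1)))
    have d2 := (((hasDerivAt_id (t : ℂ)).const_sub 1).cpow_const (c := d)
      (Or.inl (by simpa using ht.2)))
    have d3 := ((((hasDerivAt_id (t : ℂ)).const_mul z).const_sub 1).cpow_const (c := -(a + 1)) hs)
    exact ((d1.mul d2).mul d3).neg.comp_ofReal
  have h := intervalIntegral.integral_eq_sub_of_hasDerivAt_of_le zero_le_one hcont
    (fun t ht => (hder t ht).congr_deriv (g' :=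
      z * (1 - z) * (a + 1) * ((t : ℂ) ^ (b + 1 + 1 - 1) * (1 - (t : ℂ)) ^ (d - 1) *
          (1 - z * t) ^ (-(a + 1 + 1))) +
        (b + d - (a + b + 1) * z) * ((t : ℂ) ^ (b + 1 - 1) * (1 - (t : ℂ)) ^ (d - 1) *
          (1 - z * t) ^ (-(a + 1))) -
        b * ((t : ℂ) ^ (b - 1) * (1 - (t : ℂ)) ^ (d - 1) * (1 - z * t) ^ (-a))) ?_) hint
  · have hb0 : b ≠ 0 := fun h => by simp [h] at hb
    have hd0 : d ≠ 0 := fun h => by simp [h] at hd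
    rw [intervalIntegral.integral_sub ((i2.const_mul _).add (i1.const_mul _)) (i0.const_mul _),
      intervalIntegral.integral_add (i2.const_mul _) (i1.const_mul _)] at h
    simp only [intervalIntegral.integral_const_mul] at h
    simpa [eulerIntegral, Complex.zero_cpow, hb0, hd0] using h
  · have cpow_add_one (u : ℂ) {w : ℂ} (hw : w ≠ 0) : w ^ (u + 1) = w ^ u * w := by
      rw [Complex.cpow_add _ _ hw, Complex.cpow_one]
    have ht0 : (t : ℂ) ≠ 0 := by exact_mod_cast ht.1.ne'
    have ht1 : 1 - (t : ℂ) ≠ 0 := by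
      rw [sub_ne_zero]
      exact_mod_cast ht.2.ne'
    have hs0 := Complex.slitPlane_ne_zero (one_sub_mul_mem_slitPlane hz (Ioo_subset_Icc_self ht))
    have e1 : (t : ℂ) ^ b = (t : ℂ) ^ (b - 1) * t := by
      rw [← cpow_add_one _ ht0, sub_add_cancel]
    have e2 : (t : ℂ) ^ (b + 1 - 1) = (t : ℂ) ^ (b - 1) * t := by rw [← e1, add_sub_cancel_right]
    have e3 : (t : ℂ) ^ (b + 1 + 1 - 1) = (t : ℂ) ^ (b - 1) * t * t := by
      rw [← e1, add_sub_cancel_right, cpow_add_one _ ht0]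
    have e4 : (1 - (t : ℂ)) ^ d = (1 - (t : ℂ)) ^ (d - 1) * (1 - t) := by
      rw [← cpow_add_one _ ht1, sub_add_cancel]
    have e5 : (1 - z * t) ^ (-(a + 1)) = (1 - z * t) ^ (-(a + 1 + 1)) * (1 - z * t) := by
      rw [← cpow_add_one _ hs0]
      ring_nf
    have e6 : (1 - z * t) ^ (-a) =
        (1 - z * t) ^ (-(a + 1 + 1)) * (1 - z * t) * (1 - z * t) := by
      rw [← e5, ← cpow_add_one _ hs0]
      ring_nf
    simp only [id_eq, Pi.mul_apply, show -(a + 1) - 1 = -(a + 1 + 1) by ring]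
    rw [e2, e3, e5, e6, e1, e4]
    ring

/-- Decay of the Euler integral along the negative half-line, from
`(1 + s t)^(-re a) ≤ (s t)^(-κ)`. -/
theorem norm_eulerIntegral_le {a b d : ℂ} (hd : 0 < d.re) {κ : ℝ} (hκ : 0 ≤ κ)
    (hκb : κ < b.re) (hκa : κ ≤ a.re) :
    ∃ C : ℝ, 0 ≤ C ∧ ∀ s : ℝ, 0 < s → ‖eulerIntegral a b d (-(s : ℂ))‖ ≤ C * s ^ (-κ) := by
  have hbκ : 0 < (b - κ).re := by simpa using hκb
  have hint := (Complex.betaIntegral_convergent hbκ hd).norm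
  refine ⟨_, intervalIntegral.integral_nonneg (μ := volume) zero_le_one
    fun t _ => norm_nonneg ((t : ℂ) ^ (b - κ - 1) * (1 - (t : ℂ)) ^ (d - 1)), fun s hs => ?_⟩
  rw [mul_comm, ← intervalIntegral.integral_const_mul]
  refine (intervalIntegral.norm_integral_le_of_norm_le zero_le_one (ae_of_all _ fun t ht => ?_)
    (hint.const_mul _))
  have ht0 := ht.1
  have hst : 0 < s * t := mul_pos hs ht0
  have e : (1 : ℂ) - -(s : ℂ) * t = ((1 + s * t : ℝ) : ℂ) := by
    push_cast
    ring
  rw [e, norm_mul, norm_mul, norm_mul, Complex.norm_cpow_eq_rpow_re_of_pos ht0,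
    Complex.norm_cpow_eq_rpow_re_of_pos ht0, Complex.norm_cpow_eq_rpow_re_of_pos (by positivity)]
  have h1 : (1 + s * t) ^ (-a).re ≤ s ^ (-κ) * t ^ (-κ) := by
    rw [← Real.mul_rpow hs.le ht0.le]
    calc (1 + s * t) ^ (-a).re ≤ (1 + s * t) ^ (-κ) :=
          Real.rpow_le_rpow_of_exponent_le (by linarith) (by simpa using hκa)
      _ ≤ (s * t) ^ (-κ) :=
          Real.rpow_le_rpow_of_nonpos hst (by linarith) (by linarith)
  have h2 : t ^ (b - κ - 1).re = t ^ (b - 1).re * t ^ (-κ) := by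
    rw [← Real.rpow_add ht0]
    congr 1
    simp
    ring
  rw [h2]
  calc _ ≤ t ^ (b - 1).re * ‖(1 - (t : ℂ)) ^ (d - 1)‖ * (s ^ (-κ) * t ^ (-κ)) := by gcongr
    _ = _ := by ring

/-! ### Symmetry and closability of the Jacobi operator -/


theorem continuous_weight {α β : ℝ} (hα : -1 / 2 ≤ α) : Continuous (weight α β) := by
  unfold weight
  refine Continuous.mul ?_ ?_
  · exact (Real.continuous_sinh.const_mul 2).rpow_const fun x => Or.inr (by linarith)
  · refine (Real.continuous_cosh.const_mul 2).rpow_const fun x => Or.inl ?_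
    have := Real.cosh_pos x
    positivity

theorem weight_zero {α : ℝ} (β : ℝ) (hα : -1 / 2 < α) : weight α β 0 = 0 := by
  have : 2 * α + 1 ≠ 0 := by linarith
  simp [weight, Real.zero_rpow this]

theorem isLocallyFiniteMeasure_mu {α : ℝ} (β : ℝ) (hα : -1 / 2 ≤ α) :
    IsLocallyFiniteMeasure (mu α β) :=
  IsLocallyFiniteMeasure.withDensity_ofReal (continuous_weight hα)

theorem integral_mu (α β : ℝ) (f : ℝ → ℂ) :
    ∫ x, f x ∂(mu α β) = ∫ x in Ioi (0 : ℝ), (weight α β x : ℂ) * f x := by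
  unfold mu
  rw [integral_withDensity_eq_integral_toReal_smul (measurable_weight α β).ennreal_ofReal
    (ae_of_all _ fun _ => ENNReal.ofReal_lt_top)]
  refine setIntegral_congr_fun measurableSet_Ioi fun x hx => ?_
  simp only [ENNReal.toReal_ofReal (weight_pos α β hx).le, Complex.real_smul]

theorem integrable_mu_iff {E : Type*} [NormedAddCommGroup E] [NormedSpace ℝ E] (α β : ℝ)
    {f : ℝ → E} :
    Integrable f (mu α β) ↔ IntegrableOn (fun x => weight α β x • f x) (Ioi 0) := by
  unfold mu
  rw [integrable_withDensity_iff_integrable_smul' (measurable_weight α β).ennreal_ofReal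
    (ae_of_all _ fun _ => ENNReal.ofReal_lt_top), IntegrableOn]
  refine integrable_congr ?_
  filter_upwards [ae_restrict_mem measurableSet_Ioi] with x hx
  rw [ENNReal.toReal_ofReal (weight_pos α β hx).le]

/-- `Δ` is symmetric on even test functions: `A (Δf h - f Δh)` is the derivative of
`A (f h' - f' h)`, and the boundary term at `0` vanishes because `A 0 = 0`. -/
theorem integral_jacobiOp_mul {α : ℝ} (β : ℝ) (hα : -1 / 2 < α) {f h : ℝ → ℂ}
    (hf : f ∈ evenTest) (hh : h ∈ evenTest) :
    ∫ x, jacobiOp α β f x * h x ∂(mu α β) = ∫ x, f x * jacobiOp α β h x ∂(mu α β) := by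
  have i1 : Integrable (fun x => jacobiOp α β f x * h x) (mu α β) :=
    (jacobiOp_memLp hα.le 2 hf).integrable_mul (evenTest_memLp hα.le 2 hh)
  have i2 : Integrable (fun x => f x * jacobiOp α β h x) (mu α β) :=
    (evenTest_memLp hα.le 2 hf).integrable_mul (jacobiOp_memLp hα.le 2 hh)
  rw [← sub_eq_zero, ← integral_sub i1 i2, integral_mu]
  have cf := (evenTest_differentiable hf).continuous
  have ch := (evenTest_differentiable hh).continuous
  have cf' := (evenTest_contDiff_deriv hf).continuous
  have ch' := (evenTest_contDiff_deriv hh).continuous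
  have hW := (continuous_weight (β := β) hα.le)
  obtain ⟨R, -, hR⟩ := evenTest_support hf
  rw [integral_Ioi_of_hasDerivAt_of_tendsto (m := 0)
    (f := fun x => (weight α β x : ℂ) * (f x * deriv h x - deriv f x * h x))]
  · simp [weight_zero β hα]
  · exact Continuous.continuousWithinAt (by fun_prop)
  · intro x hx
    have w0 := (weight_pos α β hx).ne'
    have dw := (hasDerivAt_weight α β hx).differentiableAt.hasDerivAt.ofReal_comp
    have df := (evenTest_differentiable hf x).hasDerivAt
    have dh := (evenTest_differentiable hh x).hasDerivAt
    have df' := ((evenTest_contDiff_deriv hf).differentiable one_ne_zero x).hasDerivAt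
    have dh' := ((evenTest_contDiff_deriv hh).differentiable one_ne_zero x).hasDerivAt
    refine (dw.mul ((df.mul dh').sub (df'.mul dh))).congr_deriv ?_
    have w0' : (weight α β x : ℂ) ≠ 0 := by exact_mod_cast w0
    simp only [jacobiOp, Pi.sub_apply, Pi.mul_apply]
    push_cast
    field_simp
    ring
  · have := (integrable_mu_iff α β).1 (i1.sub i2)
    simpa [Complex.real_smul] using this
  · refine tendsto_const_nhds.congr' ?_
    filter_upwards [Filter.eventually_gt_atTop R] with x hx
    simp [(hR x hx).1, (hR x hx).2.1]

/-- The test graph is orthogonal to `(-Δh, h)` for every even test function `h`, and so is its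
closure. -/
theorem integral_eq_of_mem_closure {α : ℝ} (β : ℝ) (hα : -1 / 2 < α) (p : ℝ≥0∞) [Fact (1 ≤ p)]
    {q : Lp ℂ p (mu α β) × Lp ℂ p (mu α β)} (hq : q ∈ (testGraph α β p).topologicalClosure)
    {h : ℝ → ℂ} (hh : h ∈ evenTest) :
    ∫ x, q.2 x * h x ∂(mu α β) = ∫ x, q.1 x * jacobiOp α β h x ∂(mu α β) := by
  have hp : 1 ≤ p := Fact.out
  have : ENNReal.HolderConjugate p p.conjExponent := ENNReal.HolderConjugate.conjExponent hp
  have : Fact (1 ≤ p.conjExponent) := ⟨ENNReal.HolderConjugate.one_le p.conjExponent p⟩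
  have mh := evenTest_memLp (β := β) hα.le p.conjExponent hh
  have mh' := jacobiOp_memLp (β := β) hα.le p.conjExponent hh
  have pair {k : ℝ → ℂ} (hk : MemLp k p.conjExponent (mu α β)) (u : Lp ℂ p (mu α β)) :
      ((ContinuousLinearMap.mul ℂ ℂ).lpPairing (mu α β) p p.conjExponent).flip (hk.toLp k) u =
        ∫ x, u x * k x ∂(mu α β) := by
    rw [ContinuousLinearMap.flip_apply, ContinuousLinearMap.lpPairing_eq_integral]
    refine integral_congr_ae ?_
    filter_upwards [hk.coeFn_toLp] with x hx
    simp [hx]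
  have hclosed : IsClosed {r : Lp ℂ p (mu α β) × Lp ℂ p (mu α β) |
      ∫ x, r.2 x * h x ∂(mu α β) = ∫ x, r.1 x * jacobiOp α β h x ∂(mu α β)} := by
    simp only [← pair mh, ← pair mh']
    exact isClosed_eq (by fun_prop) (by fun_prop)
  refine closure_minimal (fun r hr => ?_) hclosed hq
  obtain ⟨f, hf, h1, h2⟩ := hr
  have e := integral_jacobiOp_mul β hα hf hh
  have e1 : ∫ x, r.2 x * h x ∂(mu α β) = ∫ x, jacobiOp α β f x * h x ∂(mu α β) :=
    integral_congr_ae (h2.mul (ae_eq_refl h))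
  have e2 : ∫ x, r.1 x * jacobiOp α β h x ∂(mu α β) =
      ∫ x, f x * jacobiOp α β h x ∂(mu α β) :=
    integral_congr_ae (h1.mul (ae_eq_refl _))
  exact e1.trans (e.trans e2.symm)

/-- Even test functions separate the points of `L^p(μ)`: a test function supported in `(0, ∞)`
is the restriction of an even one. -/
theorem eq_zero_of_integral_mul_evenTest {α : ℝ} (β : ℝ) (hα : -1 / 2 < α) (p : ℝ≥0∞)
    [Fact (1 ≤ p)] (u : Lp ℂ p (mu α β))
    (hu : ∀ h ∈ evenTest, ∫ x, u x * h x ∂(mu α β) = 0) : u = 0 := by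
  have := isLocallyFiniteMeasure_mu β hα.le
  rw [Lp.eq_zero_iff_ae_eq_zero]
  have hmem : ∀ᵐ x ∂(mu α β), x ∈ Ioi (0 : ℝ) :=
    (ae_mu_iff α β).2 (ae_restrict_mem measurableSet_Ioi)
  have hloc : LocallyIntegrable u (mu α β) := (Lp.memLp u).locallyIntegrable Fact.out
  have key := isOpen_Ioi.ae_eq_zero_of_integral_contDiff_smul_eq_zero
    (hloc.locallyIntegrableOn (Ioi (0 : ℝ))) (fun g hg hgc hgs => ?_)
  · filter_upwards [key, hmem] with x hx hx0 using hx hx0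
  · have hg0 : ∀ x : ℝ, 0 < x → g (-x) = 0 := fun x hx => by
      by_contra hne
      have := hgs (subset_tsupport g hne)
      simp only [mem_Ioi] at this
      linarith
    have hgn : HasCompactSupport fun x : ℝ => g (-x) :=
      hgc.comp_homeomorph (Homeomorph.neg ℝ)
    have := hu (fun x => ((g x + g (-x) : ℝ) : ℂ)) ⟨?_, fun x => ?_, ?_⟩
    · rw [← this]
      refine integral_congr_ae ?_
      filter_upwards [hmem] with x hx
      simp [hg0 x hx, mul_comm]
    · exact Complex.ofRealCLM.contDiff.comp (hg.add (hg.comp contDiff_neg))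
    · simp [add_comm]
    · exact (hgc.add hgn).comp_left (g := fun r : ℝ => (r : ℂ)) (by simp)

theorem jacobiTest_isClosable {α : ℝ} (β : ℝ) (hα : -1 / 2 < α) (p : ℝ≥0∞) [Fact (1 ≤ p)] :
    (jacobiTest α β p).IsClosable := by
  refine ⟨(testGraph α β p).topologicalClosure.toLinearPMap, ?_⟩
  rw [jacobiTest_graph, Submodule.toLinearPMap_graph_eq]
  intro q hq h0
  refine eq_zero_of_integral_mul_evenTest β hα p q.2 fun h hh => ?_
  rw [integral_eq_of_mem_closure β hα p hq hh, h0]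
  refine integral_eq_zero_of_ae ?_
  filter_upwards [Lp.coeFn_zero ℂ p (mu α β)] with x hx
  rw [hx, Pi.zero_apply, zero_mul]

theorem jacobiLp_graph {α : ℝ} (β : ℝ) (hα : -1 / 2 < α) (p : ℝ≥0∞) [Fact (1 ≤ p)] :
    (jacobiLp α β p).graph = (testGraph α β p).topologicalClosure := by
  rw [jacobiLp, ← (jacobiTest_isClosable β hα p).graph_closure_eq_closure_graph, jacobiTest_graph]

/-! ### Decaying solutions belong to the closure -/


theorem weight_le {α β : ℝ} (hα : -1 / 2 ≤ α) (hβ : -1 / 2 ≤ β) {x : ℝ} (hx : 0 < x) :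
    weight α β x ≤ 2 ^ (2 * β + 1) * Real.exp (2 * rho α β * x) := by
  have hs : 0 < Real.sinh x := Real.sinh_pos_iff.2 hx
  have hc := Real.cosh_pos x
  have he : Real.exp (-x) ≤ Real.exp x := Real.exp_le_exp.2 (by linarith)
  have h1 : 2 * Real.sinh x ≤ Real.exp x := by
    rw [Real.sinh_eq]
    linarith [Real.exp_pos (-x)]
  have h2 : 2 * Real.cosh x ≤ 2 * Real.exp x := by
    rw [Real.cosh_eq]
    linarith
  calc weight α β x ≤ Real.exp x ^ (2 * α + 1) * (2 * Real.exp x) ^ (2 * β + 1) := by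
        unfold weight
        gcongr <;> linarith
    _ = 2 ^ (2 * β + 1) * Real.exp (2 * rho α β * x) := by
        rw [Real.mul_rpow zero_le_two (Real.exp_pos x).le, ← Real.exp_mul, ← Real.exp_mul,
          mul_left_comm, ← Real.exp_add]
        congr 2
        unfold rho
        ring

theorem memLp_exp_neg {α β : ℝ} (hα : -1 / 2 ≤ α) (hβ : -1 / 2 ≤ β) {p : ℝ≥0∞} (hp0 : p ≠ 0)
    (hp : p ≠ ⊤) {γ : ℝ} (hγ : 2 * rho α β < γ * p.toReal) :
    MemLp (fun x : ℝ => Real.exp (-γ * x)) p (mu α β) := by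
  have hmeas : Continuous fun x : ℝ => Real.exp (-γ * x) := by fun_prop
  rw [← integrable_norm_rpow_iff hmeas.aestronglyMeasurable hp0 hp, integrable_mu_iff]
  have hint : IntegrableOn (fun x : ℝ => 2 ^ (2 * β + 1) *
      Real.exp ((2 * rho α β - γ * p.toReal) * x)) (Ioi 0) :=
    (integrableOn_exp_mul_Ioi (by linarith) 0).const_mul _
  refine hint.mono' ?_ ?_
  · exact ((measurable_weight α β).smul
      (hmeas.measurable.norm.pow_const _)).aestronglyMeasurable
  · filter_upwards [ae_restrict_mem measurableSet_Ioi] with x hx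
    have hw := weight_pos α β hx
    rw [Real.norm_of_nonneg (Real.exp_pos _).le, ← Real.exp_mul, smul_eq_mul,
      Real.norm_of_nonneg (by positivity)]
    calc _ ≤ 2 ^ (2 * β + 1) * Real.exp (2 * rho α β * x) * Real.exp (-γ * x * p.toReal) := by
          gcongr
          exact weight_le hα hβ hx
      _ = _ := by
          rw [mul_assoc, ← Real.exp_add]
          ring_nf

theorem jacobiOp_mul (α β : ℝ) {f g : ℝ → ℂ} (hf : ContDiff ℝ ∞ f) (hg : ContDiff ℝ ∞ g)
    (x : ℝ) :
    jacobiOp α β (f * g) x = jacobiOp α β f x * g x + f x * jacobiOp α β g x -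
      2 * (deriv f x * deriv g x) := by
  have f0 := hf.differentiable (by simp)
  have g0 := hg.differentiable (by simp)
  have f1 : Differentiable ℝ (deriv f) := (contDiff_infty_iff_deriv.1 hf).2.differentiable (by simp)
  have g1 : Differentiable ℝ (deriv g) := (contDiff_infty_iff_deriv.1 hg).2.differentiable (by simp)
  have h1 : deriv (f * g) = deriv f * g + f * deriv g := by
    ext y
    exact deriv_mul (f0 y) (g0 y)
  have h2 : deriv (deriv f * g + f * deriv g) x =
      deriv (deriv f) x * g x + deriv f x * deriv g x +
        (deriv f x * deriv g x + f x * deriv (deriv g) x) := by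
    rw [deriv_add ((f1 x).mul (g0 x)) ((f0 x).mul (g1 x)), deriv_mul (f1 x) (g0 x),
      deriv_mul (f0 x) (g1 x)]
  simp only [jacobiOp, h1, h2, Pi.add_apply, Pi.mul_apply]
  ring

theorem exists_evenTest_eq_one : ∃ g ∈ evenTest, ∀ x : ℝ, |x| ≤ 1 → g x = 1 := by
  let b : ContDiffBump (0 : ℝ) := ⟨1, 2, one_pos, one_lt_two⟩
  refine ⟨fun x => (b x : ℂ), ⟨Complex.ofRealCLM.contDiff.comp b.contDiff, fun x => ?_, ?_⟩,
    fun x hx => ?_⟩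
  · simp [b.neg]
  · exact b.hasCompactSupport.comp_left (g := fun r : ℝ => (r : ℂ)) (by simp)
  · have : b x = 1 := b.one_of_mem_closedBall (by simpa [b] using hx)
    simp [this]

theorem cosh_le_two_mul_sinh {x : ℝ} (hx : 1 ≤ x) : Real.cosh x ≤ 2 * Real.sinh x := by
  rw [Real.cosh_eq, Real.sinh_eq]
  -- The claim is `3 ≤ exp (2 x)`.
  have e1 : Real.exp (-x) * Real.exp (2 * x) = Real.exp x := by
    rw [← Real.exp_add]
    ring_nf
  have e2 := Real.add_one_le_exp (2 * x)
  nlinarith [Real.exp_pos (-x)]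

theorem abs_logDeriv_weight_le {α β : ℝ} (hα : -1 / 2 ≤ α) (hβ : -1 / 2 ≤ β) {x : ℝ}
    (hx : 1 ≤ x) : |deriv (weight α β) x / weight α β x| ≤ 2 * (2 * α + 1) + (2 * β + 1) := by
  have hx0 : 0 < x := by linarith
  have h1 : 0 < Real.sinh x := Real.sinh_pos_iff.2 hx0
  have h2 : 0 < Real.cosh x := Real.cosh_pos x
  rw [(hasDerivAt_weight α β hx0).deriv, mul_div_cancel_left₀ _ (weight_pos α β hx0).ne']
  have hcoth : Real.cosh x / Real.sinh x ≤ 2 := (div_le_iff₀ h1).2 (cosh_le_two_mul_sinh hx)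
  have htanh : Real.sinh x / Real.cosh x ≤ 1 := (div_le_one h2).2 (Real.sinh_lt_cosh x).le
  have a0 : 0 ≤ 2 * α + 1 := by linarith
  have b0 : 0 ≤ 2 * β + 1 := by linarith
  rw [abs_of_nonneg (by positivity)]
  nlinarith [mul_le_mul_of_nonneg_left hcoth a0, mul_le_mul_of_nonneg_left htanh b0]

/-- The dilations `g (c x)`, `0 ≤ c ≤ 1`, of a test function are bounded on `[1, ∞)` together with
their derivatives and images under `Δ`, uniformly in `c`; the restriction to `[1, ∞)` avoids the
singularity of `A' / A` at `0`. -/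
theorem exists_bound_rescaled {α β : ℝ} (hα : -1 / 2 ≤ α) (hβ : -1 / 2 ≤ β) {g : ℝ → ℂ}
    (hg : g ∈ evenTest) : ∃ C : ℝ, 0 ≤ C ∧ ∀ c : ℝ, 0 ≤ c → c ≤ 1 → ∀ x : ℝ, 1 ≤ x →
      ‖g (c * x)‖ ≤ C ∧ ‖deriv (fun x => g (c * x)) x‖ ≤ C ∧
        ‖jacobiOp α β (fun x => g (c * x)) x‖ ≤ C := by
  have hg1 := evenTest_contDiff_deriv hg
  obtain ⟨C0, h0⟩ := hg.2.2.exists_bound_of_continuous (evenTest_differentiable hg).continuous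
  obtain ⟨C1, h1⟩ := hg.2.2.deriv.exists_bound_of_continuous hg1.continuous
  obtain ⟨C2, h2⟩ := hg.2.2.deriv.deriv.exists_bound_of_continuous (hg1.continuous_deriv le_rfl)
  have n0 : 0 ≤ C0 := (norm_nonneg _).trans (h0 0)
  have n1 : 0 ≤ C1 := (norm_nonneg _).trans (h1 0)
  have n2 : 0 ≤ C2 := (norm_nonneg _).trans (h2 0)
  set K := 2 * (2 * α + 1) + (2 * β + 1) with hK
  have nK : 0 ≤ K := by linarith
  refine ⟨C0 + C1 + (C2 + K * C1), by positivity, fun c hc0 hc1 x hx => ?_⟩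
  have d1 : deriv (fun x => g (c * x)) = fun x => c • deriv g (c * x) :=
    funext fun x => deriv_comp_mul_left c g x
  have d2 : deriv (fun x => c • deriv g (c * x)) x = c • c • deriv (deriv g) (c * x) := by
    rw [deriv_fun_const_smul_field, deriv_comp_mul_left c (deriv g) x]
  have b1 : ‖c • deriv g (c * x)‖ ≤ C1 := by
    rw [norm_smul, Real.norm_of_nonneg hc0]
    exact (mul_le_of_le_one_left (norm_nonneg _) hc1).trans (h1 _)
  have b2 : ‖c • c • deriv (deriv g) (c * x)‖ ≤ C2 := by
    rw [norm_smul, norm_smul, Real.norm_of_nonneg hc0, ← mul_assoc]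
    exact (mul_le_of_le_one_left (norm_nonneg _) (mul_le_one₀ hc1 hc0 hc1)).trans (h2 _)
  have hKC : 0 ≤ K * C1 := by positivity
  refine ⟨(h0 _).trans (by linarith), ?_, ?_⟩
  · rw [d1]
    linarith
  · unfold jacobiOp
    rw [d1, d2]
    refine (norm_sub_le _ _).trans ?_
    rw [norm_neg, norm_mul, Complex.norm_real, Real.norm_eq_abs]
    have := mul_le_mul (abs_logDeriv_weight_le hα hβ hx) b1 (norm_nonneg _) nK
    linarith

/-- A smooth even solution of `Δ φ = z φ` on `(0, ∞)` that decays, along with its derivative, fast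
enough for `L^p(μ)` lies in the closure of `Δ`. It is approximated by the test functions
`g (x / n) φ x`, where `g` is a cutoff function: the errors live on `[n, ∞)`, hence are at most a
factor `exp (-δ n)` times a fixed element of `L^p(μ)`. -/
theorem mem_closure_testGraph_of_decay {α β : ℝ} (hα : -1 / 2 ≤ α) (hβ : -1 / 2 ≤ β) {p : ℝ≥0∞}
    [Fact (1 ≤ p)] (hp : p ≠ ⊤) {φ : ℝ → ℂ} (hφ : ContDiff ℝ ∞ φ) (heven : ∀ x, φ (-x) = φ x)
    {z : ℂ} (hode : ∀ x, 0 < x → jacobiOp α β φ x = z * φ x) {γ C : ℝ}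
    (hγ : 2 * rho α β < γ * p.toReal) (hC : ∀ x, 0 < x → ‖φ x‖ ≤ C * Real.exp (-γ * x))
    (hC' : ∀ x, 0 < x → ‖deriv φ x‖ ≤ C * Real.exp (-γ * x)) :
    ∃ hm : MemLp φ p (mu α β),
      (hm.toLp φ, z • hm.toLp φ) ∈ (testGraph α β p).topologicalClosure := by
  have hp1 : 1 ≤ p := Fact.out
  have hp0 : p ≠ 0 := (zero_lt_one.trans_le hp1).ne'
  have hpr : 0 < p.toReal := ENNReal.toReal_pos hp0 hp
  have hpos : ∀ᵐ x ∂(mu α β), x ∈ Ioi (0 : ℝ) :=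
    (ae_mu_iff α β).2 (ae_restrict_mem measurableSet_Ioi)
  have hm : MemLp φ p (mu α β) := by
    refine ((memLp_exp_neg hα hβ hp0 hp hγ).const_mul C).mono'
      hφ.continuous.aestronglyMeasurable ?_
    filter_upwards [hpos] with x hx using hC x hx
  refine ⟨hm, ?_⟩
  obtain ⟨γ', hγ1, hγ2⟩ := exists_between ((div_lt_iff₀ hpr).2 hγ)
  have mH := memLp_exp_neg hα hβ hp0 hp ((div_lt_iff₀ hpr).1 hγ1)
  set H : Lp ℝ p (mu α β) := mH.toLp _ with hH
  obtain ⟨g, hg, hg1⟩ := exists_evenTest_eq_one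
  obtain ⟨B, hB0, hB⟩ := exists_bound_rescaled hα hβ hg
  have C0 : 0 ≤ C := by
    have := (norm_nonneg _).trans (hC 1 one_pos)
    exact nonneg_of_mul_nonneg_left this (Real.exp_pos _)
  let c : ℕ → ℝ := fun n => ((n : ℝ) + 1)⁻¹
  have hc0 : ∀ n, 0 < c n := fun n => by positivity
  have hc1 : ∀ n, c n ≤ 1 := fun n => inv_le_one_of_one_le₀ (by simp)
  let χ : ℕ → ℝ → ℂ := fun n x => g (c n * x)
  have hχs : ∀ n, ContDiff ℝ ∞ (χ n) := fun n => hg.1.comp (contDiff_const.mul contDiff_id)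
  have hχ : ∀ n, χ n * φ ∈ evenTest := fun n => by
    refine ⟨(hχs n).mul hφ, fun x => ?_, HasCompactSupport.mul_right ?_⟩
    · simp [χ, heven, hg.2.1]
    · exact hg.2.2.comp_homeomorph (Homeomorph.mulLeft₀ (c n) (hc0 n).ne')
  have m1 := fun n => evenTest_memLp (β := β) hα p (hχ n)
  have m2 := fun n => jacobiOp_memLp (β := β) hα p (hχ n)
  let u : ℕ → Lp ℂ p (mu α β) × Lp ℂ p (mu α β) := fun n =>
    ((m1 n).toLp _, (m2 n).toLp _)
  have hu : ∀ n, u n ∈ testGraph α β p := fun n =>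
    ⟨χ n * φ, hχ n, (m1 n).coeFn_toLp, (m2 n).coeFn_toLp⟩
  have δpos : 0 < γ - γ' := by linarith
  -- On `(0, n + 1)` the cutoff function is `1`, and both errors vanish.
  have near : ∀ n : ℕ, ∀ x : ℝ, 0 < x → x < n + 1 →
      χ n x = 1 ∧ jacobiOp α β (χ n * φ) x = z * φ x := by
    intro n x hx hxn
    have one : ∀ y : ℝ, 0 < y → y < n + 1 → χ n y = 1 := fun y hy hyn => by
      refine hg1 _ ?_
      have hn : (0 : ℝ) < n + 1 := by positivity
      rw [abs_of_pos (mul_pos (hc0 n) hy), inv_mul_le_iff₀ hn]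
      linarith
    have he : χ n * φ =ᶠ[nhds x] φ := by
      filter_upwards [Ioo_mem_nhds hx hxn] with y hy
      simp [one y hy.1 hy.2]
    refine ⟨one x hx hxn, ?_⟩
    rw [← hode x hx]
    unfold jacobiOp
    rw [he.deriv.deriv_eq, he.deriv_eq]
  have decay : ∀ n : ℕ, ∀ x : ℝ, n + 1 ≤ x → Real.exp (-γ * x) ≤
      Real.exp (-(γ - γ') * n) * Real.exp (-γ' * x) := by
    intro n x hx
    rw [← Real.exp_add]
    refine Real.exp_le_exp.2 ?_
    nlinarith
  set K := (B + 1) * C + (B * C + B * (‖z‖ * C) + 2 * (B * C) + ‖z‖ * C) with hK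
  have K0 : 0 ≤ K := by positivity
  have est : ∀ n : ℕ, ∀ x : ℝ, 0 < x →
      ‖χ n x * φ x - φ x‖ ≤ K * Real.exp (-(γ - γ') * n) * Real.exp (-γ' * x) ∧
      ‖jacobiOp α β (χ n * φ) x - z * φ x‖ ≤
        K * Real.exp (-(γ - γ') * n) * Real.exp (-γ' * x) := by
    intro n x hx
    rcases lt_or_ge x (n + 1) with hxn | hxn
    · obtain ⟨h1, h2⟩ := near n x hx hxn
      rw [h1, h2, one_mul, sub_self, sub_self, norm_zero]
      exact ⟨by positivity, by positivity⟩
    · have hx1 : 1 ≤ x := le_trans (by simp) hxn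
      obtain ⟨b0, b1, b2⟩ := hB (c n) (hc0 n).le (hc1 n) x hx1
      have f0 := hC x hx
      have f1 := hC' x hx
      set E := Real.exp (-γ * x) with hE
      have E0 : 0 < E := Real.exp_pos _
      have hd := mul_le_mul_of_nonneg_left (decay n x hxn) K0
      rw [← mul_assoc] at hd
      have p1 : ‖χ n x‖ * ‖φ x‖ ≤ B * (C * E) := by gcongr
      refine ⟨le_trans ?_ hd, le_trans ?_ hd⟩
      · calc ‖χ n x * φ x - φ x‖ ≤ ‖χ n x‖ * ‖φ x‖ + ‖φ x‖ := by
              rw [← norm_mul]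
              exact norm_sub_le _ _
          _ ≤ B * (C * E) + C * E := by gcongr
          _ = (B + 1) * C * E := by ring
          _ ≤ K * E := by
              gcongr
              rw [hK]
              exact le_add_of_nonneg_right (by positivity)
      · rw [jacobiOp_mul α β (hχs n) hφ, hode x hx]
        calc _ ≤ ‖jacobiOp α β (χ n) x‖ * ‖φ x‖ + ‖χ n x‖ * (‖z‖ * ‖φ x‖) +
                2 * (‖deriv (χ n) x‖ * ‖deriv φ x‖) + ‖z‖ * ‖φ x‖ := by
              refine (norm_sub_le _ _).trans (add_le_add ((norm_sub_le _ _).trans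
                (add_le_add ((norm_add_le _ _).trans ?_) ?_)) ?_) <;> simp
          _ ≤ B * (C * E) + B * (‖z‖ * (C * E)) + 2 * (B * (C * E)) + ‖z‖ * (C * E) := by
              gcongr
          _ = (B * C + B * (‖z‖ * C) + 2 * (B * C) + ‖z‖ * C) * E := by ring
          _ ≤ K * E := by
              gcongr
              rw [hK]
              exact le_add_of_nonneg_left (by positivity)
  have lim : Filter.Tendsto (fun n : ℕ => K * Real.exp (-(γ - γ') * n) * ‖H‖) Filter.atTop
      (nhds 0) := by
    have h1 : Filter.Tendsto (fun n : ℕ => -(γ - γ') * (n : ℝ)) Filter.atTop Filter.atBot :=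
      tendsto_natCast_atTop_atTop.const_mul_atTop_of_neg (by linarith)
    simpa using ((Real.tendsto_exp_atBot.comp h1).const_mul K).mul_const ‖H‖
  refine mem_closure_of_tendsto (b := Filter.atTop) (f := u) (Filter.Tendsto.prodMk_nhds ?_ ?_)
    (Filter.Eventually.of_forall hu)
  · rw [tendsto_iff_norm_sub_tendsto_zero]
    refine squeeze_zero (fun _ => norm_nonneg _) (fun n => ?_) lim
    refine Lp.norm_le_mul_norm_of_ae_le_mul ?_
    filter_upwards [hpos, Lp.coeFn_sub (u n).1 (hm.toLp φ), (m1 n).coeFn_toLp, hm.coeFn_toLp,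
      mH.coeFn_toLp] with x hx e1 e2 e3 e4
    rw [e1, Pi.sub_apply, e2, e3, hH, e4, Real.norm_of_nonneg (Real.exp_pos _).le]
    exact (est n x hx).1
  · rw [tendsto_iff_norm_sub_tendsto_zero]
    refine squeeze_zero (fun _ => norm_nonneg _) (fun n => ?_) lim
    refine Lp.norm_le_mul_norm_of_ae_le_mul ?_
    filter_upwards [hpos, Lp.coeFn_sub (u n).2 (z • hm.toLp φ), (m2 n).coeFn_toLp,
      hm.coeFn_toLp, Lp.coeFn_smul z (hm.toLp φ), mH.coeFn_toLp] with x hx e1 e2 e3 e4 e5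
    rw [e1, Pi.sub_apply, e2, e4, Pi.smul_apply, e3, hH, e5, smul_eq_mul,
      Real.norm_of_nonneg (Real.exp_pos _).le]
    exact (est n x hx).2

/-! ### Jacobi functions -/


/-- The Euler integral in the variable `z = -sinh² x`. -/
noncomputable def eulerSinh (a b d : ℂ) (x : ℝ) : ℂ :=
  eulerIntegral a b d (-((Real.sinh x : ℝ) : ℂ) ^ 2)

theorem neg_sinh_sq_re_lt_one (x : ℝ) : (-((Real.sinh x : ℝ) : ℂ) ^ 2).re < 1 := by
  rw [← Complex.ofReal_pow, Complex.neg_re, Complex.ofReal_re]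
  nlinarith [sq_nonneg (Real.sinh x)]

theorem hasDerivAt_eulerSinh (a : ℂ) {b d : ℂ} (hb : 0 < b.re) (hd : 0 < d.re) (x : ℝ) :
    HasDerivAt (eulerSinh a b d) (-2 * a * ((Real.sinh x : ℝ) : ℂ) * ((Real.cosh x : ℝ) : ℂ) *
      eulerSinh (a + 1) (b + 1) d x) x := by
  have h1 := ((Real.hasDerivAt_sinh x).ofReal_comp.pow 2).neg
  have h2 := hasDerivAt_eulerIntegral a hb hd (neg_sinh_sq_re_lt_one x)
  refine (HasDerivAt.scomp (h := fun x : ℝ => -((Real.sinh x : ℝ) : ℂ) ^ 2) x h2 h1).congr_deriv ?_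
  simp only [eulerSinh, smul_eq_mul]
  push_cast
  ring

theorem analyticOnNhd_eulerSinh (a : ℂ) {b d : ℂ} (hb : 0 < b.re) (hd : 0 < d.re) :
    AnalyticOnNhd ℝ (eulerSinh a b d) univ := by
  have hopen : IsOpen {z : ℂ | z.re < 1} := isOpen_lt Complex.continuous_re continuous_const
  have h1 : AnalyticOnNhd ℝ (eulerIntegral a b d) {z | z.re < 1} := fun z hz =>
    ((differentiableOn_eulerIntegral a hb hd).analyticOnNhd hopen z hz).restrictScalars
  have h2 : ContDiff ℝ ω fun x : ℝ => -((Real.sinh x : ℝ) : ℂ) ^ 2 :=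
    ((Complex.ofRealCLM.contDiff.comp Real.contDiff_sinh).pow 2).neg
  exact h1.comp (contDiff_omega_iff_analyticOnNhd.1 h2) fun x _ => neg_sinh_sq_re_lt_one x

/-- The substitution `z = -sinh² x` turns the hypergeometric equation into the eigenvalue equation
of `Δ`, with eigenvalue `4 a b`. -/
theorem jacobiOp_eulerSinh {α β : ℝ} {a b d : ℂ} (hb : 0 < b.re) (hd : 0 < d.re)
    (hbd : b + d = α + 1) (hab : a + b = rho α β) (k : ℂ) {x : ℝ} (hx : 0 < x) :
    jacobiOp α β (fun x => k * eulerSinh a b d x) x =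
      4 * (a * b) * (k * eulerSinh a b d x) := by
  have hb1 : 0 < (b + 1).re := by
    rw [Complex.add_re, Complex.one_re]
    positivity
  have d1 : deriv (fun x => k * eulerSinh a b d x) = fun x => k * (-2 * a *
      ((Real.sinh x : ℝ) : ℂ) * ((Real.cosh x : ℝ) : ℂ) * eulerSinh (a + 1) (b + 1) d x) :=
    funext fun x => ((hasDerivAt_eulerSinh a hb hd x).const_mul k).deriv
  have hs := (Real.hasDerivAt_sinh x).ofReal_comp
  have hc := (Real.hasDerivAt_cosh x).ofReal_comp
  have d2 : deriv (fun x => k * (-2 * a * ((Real.sinh x : ℝ) : ℂ) * ((Real.cosh x : ℝ) : ℂ) *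
      eulerSinh (a + 1) (b + 1) d x)) x = _ := ((((hs.const_mul (-2 * a)).mul hc).mul
    (hasDerivAt_eulerSinh (a + 1) hb1 hd x)).const_mul k).deriv
  have hcont := eulerIntegral_contiguous a hb hd (neg_sinh_sq_re_lt_one x)
  have s0 : ((Real.sinh x : ℝ) : ℂ) ≠ 0 := by
    exact_mod_cast (Real.sinh_pos_iff.2 hx).ne'
  have c0 : ((Real.cosh x : ℝ) : ℂ) ≠ 0 := by exact_mod_cast (Real.cosh_pos x).ne'
  have hsq : ((Real.cosh x : ℝ) : ℂ) ^ 2 = ((Real.sinh x : ℝ) : ℂ) ^ 2 + 1 := by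
    exact_mod_cast Real.cosh_sq x
  have hβ : (β : ℂ) = a + b - α - 1 := by
    rw [hab]
    unfold rho
    push_cast
    ring
  unfold jacobiOp
  rw [(hasDerivAt_weight α β hx).deriv, mul_div_cancel_left₀ _ (weight_pos α β hx).ne', d1, d2]
  simp only [Pi.mul_apply, eulerSinh] at *
  push_cast [-Complex.ofReal_sinh, -Complex.ofReal_cosh]
  rw [hβ]
  rw [hbd] at hcont
  generalize eulerIntegral a b d _ = E0 at *
  generalize eulerIntegral (a + 1) (b + 1) d _ = E1 at *
  generalize eulerIntegral (a + 1 + 1) (b + 1 + 1) d _ = E2 at *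
  generalize ((Real.sinh x : ℝ) : ℂ) = S at *
  generalize ((Real.cosh x : ℝ) : ℂ) = T at *
  have q1 : T / S * (S * T) = T ^ 2 := by
    field_simp
  have q2 : S / T * (S * T) = S ^ 2 := by
    field_simp
  linear_combination (4 * a * k) * hcont +
    (-4 * a * (a + 1) * S ^ 2 * k * E2 + 4 * (α + 1) * a * k * E1) * hsq +
    2 * a * k * E1 * (2 * α + 1) * q1 + 2 * a * k * E1 * (2 * (a + b - α - 1) + 1) * q2

theorem exists_exp_bound {f : ℝ → ℂ} (hf : Continuous f) {γ C : ℝ} (hγ : 0 ≤ γ)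
    (h : ∀ x, 1 ≤ x → ‖f x‖ ≤ C * Real.exp (-γ * x)) :
    ∃ C', ∀ x, 0 < x → ‖f x‖ ≤ C' * Real.exp (-γ * x) := by
  obtain ⟨M, hM⟩ := (isCompact_Icc (a := (0 : ℝ)) (b := 1)).exists_bound_of_continuousOn
    hf.continuousOn
  have hM0 : 0 ≤ M := (norm_nonneg _).trans (hM 0 (by simp))
  refine ⟨max C (M * Real.exp γ), fun x hx => ?_⟩
  rcases le_total 1 x with h1 | h1
  · exact (h x h1).trans (by gcongr; exact le_max_left _ _)
  · calc ‖f x‖ ≤ M := hM x ⟨hx.le, h1⟩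
      _ ≤ M * (Real.exp γ * Real.exp (-γ * x)) := by
          rw [← Real.exp_add]
          exact le_mul_of_one_le_right hM0 (Real.one_le_exp (by nlinarith))
      _ = M * Real.exp γ * Real.exp (-γ * x) := by ring
      _ ≤ _ := by gcongr; exact le_max_right _ _

theorem sinh_sq_rpow_neg_le {κ : ℝ} (hκ : 0 ≤ κ) {x : ℝ} (hx : 1 ≤ x) :
    (Real.sinh x ^ 2) ^ (-κ) ≤ 9 ^ κ * Real.exp (-(2 * κ) * x) := by
  have h := cosh_le_two_mul_sinh hx
  have he : Real.exp x = Real.cosh x + Real.sinh x := (Real.cosh_add_sinh x).symm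
  have h3 : Real.exp x / 3 ≤ Real.sinh x := by linarith
  calc (Real.sinh x ^ 2) ^ (-κ) ≤ ((Real.exp x / 3) ^ 2) ^ (-κ) :=
        Real.rpow_le_rpow_of_nonpos (by positivity) (by gcongr) (by linarith)
    _ = 9 ^ κ * Real.exp (-(2 * κ) * x) := by
        rw [div_pow, ← Real.exp_nat_mul, Real.div_rpow (Real.exp_pos _).le (by norm_num),
          ← Real.exp_mul, Real.rpow_neg (by norm_num), div_inv_eq_mul, mul_comm]
        norm_num
        left
        ring

theorem exists_bound_eulerSinh {a b d : ℂ} (hd : 0 < d.re) {κ : ℝ} (hκ : 0 ≤ κ)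
    (hκb : κ < b.re) (hκa : κ ≤ a.re) (k : ℂ) :
    ∃ C : ℝ, (∀ x, 0 < x → ‖k * eulerSinh a b d x‖ ≤ C * Real.exp (-(2 * κ) * x)) ∧
      ∀ x, 0 < x →
        ‖deriv (fun x => k * eulerSinh a b d x) x‖ ≤ C * Real.exp (-(2 * κ) * x) := by
  have hb : 0 < b.re := hκ.trans_lt hκb
  obtain ⟨C0, n0, h0⟩ := norm_eulerIntegral_le hd hκ hκb hκa
  obtain ⟨C1, n1, h1⟩ := norm_eulerIntegral_le (a := a + 1) (b := b + 1) (κ := κ + 1) hd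
    (by linarith) (by simpa using hκb) (by simpa using hκa)
  have hana := analyticOnNhd_eulerSinh a hb hd
  have d1 : deriv (fun x => k * eulerSinh a b d x) = fun x => k * (-2 * a *
      ((Real.sinh x : ℝ) : ℂ) * ((Real.cosh x : ℝ) : ℂ) * eulerSinh (a + 1) (b + 1) d x) :=
    funext fun x => ((hasDerivAt_eulerSinh a hb hd x).const_mul k).deriv
  have hb1 : 0 < (b + 1).re := by
    rw [Complex.add_re, Complex.one_re]
    positivity
  have c0 : Continuous (eulerSinh a b d) := continuousOn_univ.1 hana.continuousOn
  have c1 : Continuous (eulerSinh (a + 1) (b + 1) d) :=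
    continuousOn_univ.1 (analyticOnNhd_eulerSinh (a + 1) hb1 hd).continuousOn
  have bd0 := exists_exp_bound (f := fun x => k * eulerSinh a b d x) (by fun_prop)
    (γ := 2 * κ) (C := ‖k‖ * (C0 * 9 ^ κ)) (by positivity) fun x hx => by
      have hs : 0 < Real.sinh x := Real.sinh_pos_iff.2 (by linarith)
      have := h0 (Real.sinh x ^ 2) (by positivity)
      rw [norm_mul, eulerSinh, ← Complex.ofReal_pow]
      calc _ ≤ ‖k‖ * (C0 * (9 ^ κ * Real.exp (-(2 * κ) * x))) := by
            gcongr
            exact this.trans (by gcongr; exact sinh_sq_rpow_neg_le hκ hx)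
        _ = _ := by ring
  have bd1 := exists_exp_bound (f := deriv (fun x => k * eulerSinh a b d x))
    (by rw [d1]; fun_prop)
    (γ := 2 * κ) (C := ‖k‖ * (4 * ‖a‖ * C1 * 9 ^ κ)) (by positivity) fun x hx => by
      have hs : 0 < Real.sinh x := Real.sinh_pos_iff.2 (by linarith)
      have hc := cosh_le_two_mul_sinh hx
      have hE := h1 (Real.sinh x ^ 2) (by positivity)
      have e : Real.sinh x ^ 2 * (Real.sinh x ^ 2) ^ (-(κ + 1)) = (Real.sinh x ^ 2) ^ (-κ) := by
        rw [mul_comm, ← Real.rpow_add_one (by positivity)]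
        ring_nf
      rw [d1]
      simp only [norm_mul, norm_neg, Complex.norm_real, Real.norm_of_nonneg hs.le,
        Real.norm_of_nonneg (Real.cosh_pos x).le, eulerSinh, ← Complex.ofReal_pow,
        Complex.norm_ofNat]
      calc _ ≤ ‖k‖ * (2 * ‖a‖ * Real.sinh x * (2 * Real.sinh x) *
              (C1 * (Real.sinh x ^ 2) ^ (-(κ + 1)))) := by gcongr
        _ = ‖k‖ * (4 * ‖a‖ * C1 *
              (Real.sinh x ^ 2 * (Real.sinh x ^ 2) ^ (-(κ + 1)))) := by ring
        _ ≤ ‖k‖ * (4 * ‖a‖ * C1 * (9 ^ κ * Real.exp (-(2 * κ) * x))) := by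
            rw [e]
            gcongr
            exact sinh_sq_rpow_neg_le hκ hx
        _ = _ := by ring
  obtain ⟨K0, k0⟩ := bd0
  obtain ⟨K1, k1⟩ := bd1
  refine ⟨max K0 K1, fun x hx => (k0 x hx).trans ?_, fun x hx => (k1 x hx).trans ?_⟩
  · gcongr
    exact le_max_left _ _
  · gcongr
    exact le_max_right _ _

/-- An eigenfunction of `Δ` in `L^p(μ)` given by a hypergeometric function whose parameters
satisfy the conditions for Euler's formula. The hypothesis on `b` is the condition that
`x ↦ exp (-2 x re b)` lie in `L^p(μ)`. -/
theorem exists_eigenfunction {α β : ℝ} (hβ : -1 / 2 ≤ β) (hβα : β ≤ α) (hα : -1 / 2 < α)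
    (p : ℝ≥0∞) [Fact (1 ≤ p)] (hp : p ≠ ⊤) {a b : ℂ} (hab : a + b = rho α β)
    (hle : b.re ≤ a.re) (hbp : rho α β / p.toReal < b.re) :
    ∃ φ : ℝ → ℂ, AnalyticOnNhd ℝ φ univ ∧
      (∀ x : ℝ, Real.sinh x ^ 2 < 1 →
        φ x = ordinaryHypergeometric (𝕂 := ℂ) a b ((α : ℂ) + 1)
          (-((Real.sinh x : ℝ) : ℂ) ^ 2)) ∧
      (∀ x : ℝ, 0 < x → jacobiOp α β φ x = 4 * (a * b) * φ x) ∧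
      ∃ hφ : MemLp φ p (mu α β), hφ.toLp φ ≠ 0 ∧
        (hφ.toLp φ, (4 * (a * b)) • hφ.toLp φ) ∈ (jacobiLp α β p).graph := by
  have hpr : 0 < p.toReal :=
    ENNReal.toReal_pos (zero_lt_one.trans_le (Fact.out : 1 ≤ p)).ne' hp
  have hρ : 0 < rho α β := by
    unfold rho
    linarith
  have hre : a.re + b.re = rho α β := by simpa using congrArg Complex.re hab
  have hb : 0 < b.re := (div_pos hρ hpr).trans hbp
  obtain ⟨d, hd⟩ : ∃ d : ℂ, d = α + 1 - b := ⟨_, rfl⟩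
  have hbd : b + d = α + 1 := by
    rw [hd]
    ring
  have hdre : 0 < d.re := by
    have : d.re = α + 1 - b.re := by simp [hd]
    unfold rho at hre
    linarith
  obtain ⟨κ, hκ1, hκ2⟩ := exists_between hbp
  have hκ : 0 < κ := (div_pos hρ hpr).trans hκ1
  have hB : Complex.betaIntegral b d ≠ 0 := by
    rw [Complex.betaIntegral_eq_Gamma_mul_div _ _ hb hdre]
    have hbd' : 0 < (b + d).re := by
      rw [Complex.add_re]
      positivity
    exact div_ne_zero (mul_ne_zero (Complex.Gamma_ne_zero_of_re_pos hb)
      (Complex.Gamma_ne_zero_of_re_pos hdre)) (Complex.Gamma_ne_zero_of_re_pos hbd')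
  set φ : ℝ → ℂ := fun x => (Complex.betaIntegral b d)⁻¹ * eulerSinh a b d x with hφ
  have hana : AnalyticOnNhd ℝ φ univ := analyticOnNhd_const.mul (analyticOnNhd_eulerSinh a hb hdre)
  have hode : ∀ x : ℝ, 0 < x → jacobiOp α β φ x = 4 * (a * b) * φ x := fun x hx =>
    jacobiOp_eulerSinh hb hdre hbd hab _ hx
  have hgauss : ∀ x : ℝ, Real.sinh x ^ 2 < 1 →
      φ x = ordinaryHypergeometric (𝕂 := ℂ) a b ((α : ℂ) + 1)
        (-((Real.sinh x : ℝ) : ℂ) ^ 2) := fun x hx => by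
    have hz : ‖-((Real.sinh x : ℝ) : ℂ) ^ 2‖ < 1 := by
      rw [norm_neg, norm_pow, Complex.norm_real, Real.norm_eq_abs, sq_abs]
      exact hx
    simp only [hφ, eulerSinh]
    rw [eulerIntegral_eq_ordinaryHypergeometric a hb hdre hz, hbd, inv_mul_cancel_left₀ hB]
  have hsmooth : ContDiff ℝ ∞ φ := (contDiff_omega_iff_analyticOnNhd.2 hana).of_le le_top
  have heven : ∀ x, φ (-x) = φ x := fun x => by simp [hφ, eulerSinh]
  obtain ⟨C, hC, hC'⟩ := exists_bound_eulerSinh hdre hκ.le hκ2 (hκ2.le.trans hle)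
    (Complex.betaIntegral b d)⁻¹
  have hγ : 2 * rho α β < 2 * κ * p.toReal := by
    have := (div_lt_iff₀ hpr).1 hκ1
    linarith
  obtain ⟨hm, hmem⟩ := mem_closure_testGraph_of_decay hα.le hβ hp hsmooth heven hode hγ hC hC'
  refine ⟨φ, hana, hgauss, hode, hm, fun h0 => ?_, by rwa [jacobiLp_graph β hα p]⟩
  -- The value at `0` is `1`, while a null function that is continuous vanishes on `[0, ∞)`.
  have hae : φ =ᵐ[mu α β] 0 := by
    have := hm.coeFn_toLp
    rw [h0] at this
    exact this.symm.trans (Lp.coeFn_zero _ _ _)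
  have hE : EqOn φ (fun _ => 0) (Ioi 0) :=
    Measure.eqOn_open_of_ae_eq ((ae_mu_iff α β).1 hae) isOpen_Ioi
      hsmooth.continuous.continuousOn continuousOn_const
  have hE0 := hE.closure hsmooth.continuous continuous_const
  rw [closure_Ioi] at hE0
  have h1 := hgauss 0 (by simp)
  rw [hE0 self_mem_Ici] at h1
  simp at h1

end JacobiAnalysis

theorem mainTheorem6 (α β : ℝ) (hβ : -1 / 2 ≤ β) (hβα : β ≤ α) (hα : -1 / 2 < α)
    (p : ENNReal) [Fact (1 ≤ p)] (hp : 2 < p) (hp_top : p < ⊤) :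
    (∀ lam ∈ interior (strip α β p), ∃ φ : ℝ → ℂ,
      IsJacobiFunction α β lam φ ∧
      (∀ x : ℝ, 0 < x → jacobiOp α β φ x = (lam ^ 2 + (rho α β : ℂ) ^ 2) * φ x) ∧
      ∃ hφ : MeasureTheory.MemLp φ p (mu α β),
        hφ.toLp φ ≠ 0 ∧
        ∃ hdom : hφ.toLp φ ∈ (jacobiLp α β p).domain,
          jacobiLp α β p ⟨hφ.toLp φ, hdom⟩ =
            (lam ^ 2 + (rho α β : ℂ) ^ 2) • hφ.toLp φ) ∧
    parabolicRegion α β p ⊆ pointSpectrum (jacobiLp α β p) := by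
  have main : ∀ lam ∈ interior (strip α β p), ∃ φ : ℝ → ℂ,
      IsJacobiFunction α β lam φ ∧
      (∀ x : ℝ, 0 < x → jacobiOp α β φ x = (lam ^ 2 + (rho α β : ℂ) ^ 2) * φ x) ∧
      ∃ hφ : MeasureTheory.MemLp φ p (mu α β),
        hφ.toLp φ ≠ 0 ∧
        ∃ hdom : hφ.toLp φ ∈ (jacobiLp α β p).domain,
          jacobiLp α β p ⟨hφ.toLp φ, hdom⟩ =
            (lam ^ 2 + (rho α β : ℂ) ^ 2) • hφ.toLp φ := by
    intro lam hlam
    have hp2 : 2 < p.toReal := by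
      simpa using (ENNReal.toReal_lt_toReal ENNReal.ofNat_ne_top hp_top.ne).2 hp
    have him : |lam.im| < (1 - 2 / p.toReal) * rho α β := by
      have hs : strip α β p = Complex.im ⁻¹'
          Icc (-(|1 - 2 / p.toReal| * rho α β)) (|1 - 2 / p.toReal| * rho α β) := by
        ext z
        exact abs_le (a := z.im)
      rw [hs, Complex.interior_preimage_im, interior_Icc] at hlam
      have h2 : 2 / p.toReal ≤ 1 := (div_le_one (by linarith)).2 hp2.le
      have h3 : |1 - 2 / p.toReal| = 1 - 2 / p.toReal := abs_of_nonneg (by linarith)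
      rw [h3] at hlam
      exact abs_lt.2 hlam
    -- Euler's formula needs the parameter with the smaller real part in the second place.
    obtain ⟨a, b, hF, hab, hprod, hle, hb⟩ : ∃ a b : ℂ,
        (∀ w : ℂ, ordinaryHypergeometric (𝕂 := ℂ) a b ((α : ℂ) + 1) w =
          ordinaryHypergeometric (𝕂 := ℂ) ((rho α β - Complex.I * lam) / 2)
            ((rho α β + Complex.I * lam) / 2) ((α : ℂ) + 1) w) ∧
        a + b = rho α β ∧ 4 * (a * b) = lam ^ 2 + (rho α β : ℂ) ^ 2 ∧ b.re ≤ a.re ∧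
        b.re = (rho α β - |lam.im|) / 2 := by
      rcases le_total 0 lam.im with h | h
      · refine ⟨(rho α β - Complex.I * lam) / 2, (rho α β + Complex.I * lam) / 2,
          fun w => rfl, by ring, ?_, ?_, ?_⟩
        · linear_combination (-lam ^ 2) * Complex.I_sq
        · simp
          linarith
        · simp [abs_of_nonneg h]
          ring
      · refine ⟨(rho α β + Complex.I * lam) / 2, (rho α β - Complex.I * lam) / 2,
          fun w => ?_, by ring, ?_, ?_, ?_⟩
        · unfold ordinaryHypergeometric
          rw [ordinaryHypergeometricSeries_symm]
        · linear_combination (-lam ^ 2) * Complex.I_sq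
        · simp
          linarith
        · simp [abs_of_nonpos h]
    have hbp : rho α β / p.toReal < b.re := by
      rw [hb]
      have e : (1 - 2 / p.toReal) * rho α β = rho α β - 2 * (rho α β / p.toReal) := by ring
      rw [e] at him
      linarith
    obtain ⟨φ, hana, hgauss, hode, hφ, hne, hgraph⟩ :=
      exists_eigenfunction hβ hβα hα p hp_top.ne hab hle hbp
    rw [hprod] at hode hgraph
    obtain ⟨y, hy1, hy2⟩ := (LinearPMap.mem_graph_iff _).1 hgraph
    dsimp only at hy1 hy2
    have hdom : hφ.toLp φ ∈ (jacobiLp α β p).domain := by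
      rw [← hy1]
      exact y.2
    refine ⟨φ, ⟨hana, fun x hx => (hgauss x hx).trans (hF _)⟩, hode, hφ, hne, hdom, ?_⟩
    rw [← hy2]
    congr 1
    exact Subtype.ext hy1.symm
  refine ⟨main, ?_⟩
  rintro _ ⟨lam, hlam, rfl⟩
  obtain ⟨φ, -, -, hφ, hne, hdom, heq⟩ := main lam hlam
  exact ⟨⟨_, hdom⟩, hne, heq⟩
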